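/- Notation. For a finite group $G$, let $\mathbb B(G)=\mathbb C\otimes B^{\mathbb C^\times}(G)$ be the monomial Burnside algebra, with basis the $G$-conjugacy classes $[K,\psi]_G$ of pairs $K\le G$, $\psi\in\operatorname{Hom}(K,\mathbb C^\times)$, equivalently the classes of transitive $\mathbb C^\times$-fibered $G$-sets. A finite $(H,G)$-biset $U$ induces a linear map $\mathbb B(U):\mathbb B(G)\to\mathbb B(H)$, $[X]\mapsto[U\otimes_G X]$, where $U\otimes_G X$ is the set of points of $U\times_G X$ with trivial $\mathbb C^\times$-stabilizer; $\operatorname{Def}^G_{G/N}$ is induced by the $(G/N,G)$-biset $G/N$. The group $\operatorname{Aut}(G)$ acts on $\mathbb B(G)$ by transport of structure. Let $\mathbb S_p(G)$ be the kernel of the linearization map $\operatorname{Lin}_G$, $[K,\psi]_G\mapsto\operatorname{Ind}_K^G\psi$, with values in $\mathbb C\otimes R_{\mathbb C}(G)$. For a finite $p$-group $G$, the restriction kernel $\mathcal K\mathbb S_p(G)$ is the set of all $x\in\mathbb S_p(G)$ with $\mathbb B(U)x=0$ for every finite $p$-group $H$ with $|H|<|G|$ and every finite $(H,G)$-biset $U$.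 For $H\le G$ and $h\in H$, let $s^G_{H,h}([K,\psi]_G)=\sum_{xK\subseteq G,\;H\le xKx^{-1}}\psi(x^{-1}hx)$, and let $e^G_{H,h}\in\mathbb B(G)$ be the primitive idempotent characterized by $s^G_{K,k}(e^G_{H,h})=1$ if $(K,kK')$ is $G$-conjugate to $(H,hH')$ and $0$ otherwise, where $'$ denotes derived subgroups. Let $\widetilde{e_G^G}=\frac1{|G|}\sum_{K\le G}|K|\,\mu(K,G)\operatorname{Ind}_K^G\operatorname{Res}^G_K$, where $\mu$ is the Möbius function of the poset of subgroups of $G$. Theorem. Let $p$ be a prime, $k\ge2$, and let $G$ be cyclic of order $p^k$. For $0\le l<k$ let $H_l=\langle h_l\rangle$ be the subgroup of order $p^l$ with a chosen generator $h_l$, let $Z=H_1$, and let $\operatorname{Aut}_Z(H_l)$ be the group of all $\alpha\in\operatorname{Aut}(H_l)$ with $x^{-1}\alpha(x)\in Z$ for all $x\in H_l$. For a linear character $\phi:\operatorname{Aut}(H_l)\to\mathbb C^\times$ put $$e_{G,l,\phi}=\sum_{\alpha\in\operatorname{Aut}(H_l)}\phi(\alpha^{-1})\,e^G_{G,\alpha(h_l)}.$$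 The idempotents $e^G_{G,g}$ $(g\in G)$ exist and are uniquely determined, and the following hold. 1. The elements $e_{G,l,\phi}$ ($0\le l<k$, $\phi\in\operatorname{Hom}(\operatorname{Aut}(H_l),\mathbb C^\times)$) form a $\mathbb C$-basis of $\widetilde{e_G^G}\,\mathbb S_p(G)$. 2. $\beta\cdot e_{G,l,\phi}=\phi(\beta|_{H_l})\,e_{G,l,\phi}$ for all $\beta\in\operatorname{Aut}(G)$. 3. If $2\le l<k$, then $\operatorname{Def}^G_{G/Z}e_{G,l,\phi}=0$ if and only if $\ker\phi\cap\operatorname{Aut}_Z(H_l)=\{1\}$. 4. $\mathcal K\mathbb S_p(G)=\widetilde{e_G^G}\,\mathbb S_p(G)\cap\ker\operatorname{Def}^G_{G/Z}$, and it has as $\mathbb C$-basis the elements $e_{G,l,\phi}$ with $2\le l<k$ and $\ker\phi\cap\operatorname{Aut}_Z(H_l)=\{1\}$, the elements $e_{G,1,\phi}$ with $\phi\ne1$, and the element $e_{G,1,1}+(1-p)\,e_{G,0,1}$. 5. $\mathcal K\mathbb S_p(G)$ is stable under $\operatorname{Aut}(G)$ and is isomorphic, as a $\mathbb C[\operatorname{Aut}(G)]$-module,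 to the direct sum of all non-primitive irreducible $\mathbb C[\operatorname{Aut}(G)]$-modules, each occurring exactly once. Here the irreducible $\mathbb C[\operatorname{Aut}(G)]$-modules are, up to isomorphism and without repetition, the one-dimensional modules $\mathbb C_\chi$ for the characters $\chi:\operatorname{Aut}(G)\to\mathbb C^\times$, and $\mathbb C_\chi$ is called primitive if $\chi$ is primitive as a Dirichlet character modulo $p^k$ under $\operatorname{Aut}(G)\cong(\mathbb Z/p^k)^\times$. -/

import Mathlib

universe u

open scoped DirectSum

noncomputable section

namespace MonomialBurnside

/-! ### Monomial pairs and the monomial Burnside algebra -/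

/-- A pair `(H, φ)` with `H ≤ G` and `φ : H → ℂˣ` a homomorphism, i.e. the stabilizing pair of a
point of a `ℂˣ`-fibered `G`-set. -/
structure MonomialPair (G : Type u) [Group G] where
  sub : Subgroup G
  char : sub →* ℂˣ

namespace MonomialPair

variable {G G₁ : Type u} [Group G] [Group G₁]

open Classical in
/-- The character `φ` of `(H, φ)`, with values in `ℂ`, extended by zero from `H` to `G`. -/
def val (P : MonomialPair G) (g : G) : ℂ :=
  if h : g ∈ P.sub then (P.char ⟨g, h⟩ : ℂ) else 0

theorem val_of_mem (P : MonomialPair G) {g : G} (h : g ∈ P.sub) :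
    P.val g = (P.char ⟨g, h⟩ : ℂ) := by
  simp [val, h]

theorem val_ne_zero_iff (P : MonomialPair G) (g : G) : P.val g ≠ 0 ↔ g ∈ P.sub := by
  by_cases h : g ∈ P.sub <;> simp [val, h]

theorem val_mul (P : MonomialPair G) {g k : G} (hg : g ∈ P.sub) (hk : k ∈ P.sub) :
    P.val (g * k) = P.val g * P.val k := by
  rw [P.val_of_mem hg, P.val_of_mem hk, P.val_of_mem (P.sub.mul_mem hg hk), ← Units.val_mul,
    ← map_mul]
  rfl

@[ext]
theorem ext_val {P Q : MonomialPair G} (h : ∀ g, P.val g = Q.val g) : P = Q := by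
  have hs : P.sub = Q.sub := by
    ext g
    rw [← P.val_ne_zero_iff, ← Q.val_ne_zero_iff, h]
  obtain ⟨H, φ⟩ := P
  obtain ⟨K, ψ⟩ := Q
  dsimp only at hs
  subst hs
  congr 1
  ext g
  have := h g
  rw [val_of_mem _ g.2, val_of_mem _ g.2] at this
  exact this

/-- Transport of a pair along an isomorphism `β`: `(H, φ) ↦ (β(H), φ ∘ β⁻¹)`. -/
def map (β : G ≃* G₁) (P : MonomialPair G) : MonomialPair G₁ where
  sub := P.sub.map β.toMonoidHom
  char := P.char.comp (β.subgroupMap P.sub).symm.toMonoidHom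

theorem mem_map_sub (β : G ≃* G₁) (P : MonomialPair G) (g : G₁) :
    g ∈ (P.map β).sub ↔ β.symm g ∈ P.sub :=
  Subgroup.mem_map_equiv

theorem val_map (β : G ≃* G₁) (P : MonomialPair G) (g : G₁) :
    (P.map β).val g = P.val (β.symm g) := by
  by_cases h : β.symm g ∈ P.sub
  · rw [val_of_mem _ h, val_of_mem _ ((mem_map_sub β P g).2 h)]
    rfl
  · have h' : g ∉ (P.map β).sub := fun h' => h ((mem_map_sub β P g).1 h')
    simp [val, h, h']

/-- `G`-conjugacy of pairs: `ᵍ(H, φ) = (gHg⁻¹, φ(g⁻¹ · g))`. -/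
instance conjSetoid (G : Type u) [Group G] : Setoid (MonomialPair G) where
  r P Q := ∃ g : G, P.map (MulAut.conj g) = Q
  iseqv :=
    { refl := fun P => ⟨1, by ext x; rw [val_map, map_one]; rfl⟩
      symm := by
        rintro P Q ⟨g, rfl⟩
        exact ⟨g⁻¹, by ext x; simp [val_map, mul_assoc]⟩
      trans := by
        rintro P Q R ⟨g, rfl⟩ ⟨h, rfl⟩
        exact ⟨h * g, by ext x; rw [val_map, val_map, val_map, map_mul]; rfl⟩ }

end MonomialPair

/-- The set of `G`-conjugacy classes `[H, φ]_G` of monomial pairs; equivalently, of isomorphism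
classes of transitive `ℂˣ`-fibered `G`-sets. -/
abbrev MonomialClass (G : Type u) [Group G] : Type u :=
  Quotient (MonomialPair.conjSetoid G)

/-- The monomial Burnside algebra `ℂ ⊗ B^{ℂˣ}(G)` (as a vector space), with its basis `[H, φ]_G`. -/
abbrev MonBurnside (G : Type u) [Group G] : Type u :=
  MonomialClass G →₀ ℂ

/-- The basis element `[H, φ]_G`. -/
def basisElt {G : Type u} [Group G] (P : MonomialPair G) : MonBurnside G :=
  Finsupp.single (Quotient.mk _ P) 1

/-! ### Linearization and species -/

section Lin

variable {G : Type u} [Group G]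

/-- The induced character
`Ind_H^G φ (g) = ∑_{xH ⊆ G, g ∈ xHx⁻¹} φ(x⁻¹ g x) = |H|⁻¹ ∑_{x ∈ G, g ∈ xHx⁻¹} φ(x⁻¹ g x)`. -/
def indChar (P : MonomialPair G) (g : G) : ℂ :=
  (Nat.card P.sub : ℂ)⁻¹ * ∑ᶠ x : G, P.val (x⁻¹ * g * x)

theorem card_map_sub (P : MonomialPair G) (β : MulAut G) :
    Nat.card (P.map β).sub = Nat.card P.sub :=
  Nat.card_congr (β.subgroupMap P.sub).toEquiv.symm

theorem indChar_conj {P Q : MonomialPair G} (h : P ≈ Q) : indChar P = indChar Q := by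
  obtain ⟨a, rfl⟩ := h
  funext g
  unfold indChar
  rw [card_map_sub]
  congr 1
  rw [← finsum_comp_equiv (Equiv.mulRight a)]
  refine finsum_congr fun x => ?_
  simp [MonomialPair.val_map, mul_assoc]

/-- The linearization map `Lin_G`, `[H, φ]_G ↦ Ind_H^G φ`. The target `ℂ ⊗ R_ℂ(G)` is viewed
inside the functions on `G`. -/
def lin (G : Type u) [Group G] : MonBurnside G →ₗ[ℂ] (G → ℂ) :=
  Finsupp.linearCombination ℂ
    (Quotient.lift indChar fun _ _ h => indChar_conj h)

open Classical in
/-- `s_{H,h}^G([K, ψ]_G) = ∑_{xK ⊆ G, H ≤ xKx⁻¹} ψ(x⁻¹ h x)`, the sum over cosets being written as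
`|K|⁻¹` times the sum over elements. -/
def speciesPair (H : Subgroup G) (h : G) (P : MonomialPair G) : ℂ :=
  (Nat.card P.sub : ℂ)⁻¹ *
    ∑ᶠ x : G, if ∀ y ∈ H, x⁻¹ * y * x ∈ P.sub then P.val (x⁻¹ * h * x) else 0

theorem speciesPair_conj (H : Subgroup G) (h : G) {P Q : MonomialPair G} (hPQ : P ≈ Q) :
    speciesPair H h P = speciesPair H h Q := by
  classical
  obtain ⟨a, rfl⟩ := hPQ
  unfold speciesPair
  rw [card_map_sub]
  congr 1
  rw [← finsum_comp_equiv (Equiv.mulRight a)]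
  refine finsum_congr fun x => ?_
  refine if_congr (forall₂_congr fun y _ => ?_) ?_ rfl
  · rw [MonomialPair.mem_map_sub]
    simp [mul_assoc]
  · rw [MonomialPair.val_map]
    simp [mul_assoc]

/-- The species `s_{H,h}^G` for `H ≤ G` and `h ∈ H` (it only depends on the class of `h` modulo
the derived subgroup of `H`). -/
def species (H : Subgroup G) (h : G) : MonBurnside G →ₗ[ℂ] ℂ :=
  Finsupp.linearCombination ℂ
    (Quotient.lift (speciesPair H h) fun _ _ hPQ => speciesPair_conj H h hPQ)

/-- `(H, hH')` and `(K, kK')` are `G`-conjugate. -/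
def PairConj (H : Subgroup G) (h : G) (K : Subgroup G) (k : G) : Prop :=
  ∃ g : G, H.map (MulAut.conj g).toMonoidHom = K ∧ (g * h * g⁻¹) * k⁻¹ ∈ ⁅K, K⁆

open Classical in
/-- The property characterizing the primitive idempotent `e_{H,h}^G`: the species `s_{K,k}^G` takes
the value `1` on it if `(K, k) =_G (H, h)` and `0` otherwise. -/
def IsPrimIdem (H : Subgroup G) (h : G) (x : MonBurnside G) : Prop :=
  ∀ (K : Subgroup G) (k : G), k ∈ K → species K k x = if PairConj H h K k then 1 else 0

/-- The primitive idempotent `e_{H,h}^G`. -/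
def primIdem (H : Subgroup G) (h : G) : MonBurnside G :=
  Classical.epsilon (IsPrimIdem H h)

end Lin

/-! ### The action of bisets -/

section Biset

variable {G H : Type u} [Group G] [Group H]

/-- The isomorphisms of `G` act on `ℂ ⊗ B^{ℂˣ}(G)` by transport of structure. -/
theorem map_conj (β : MulAut G) {P Q : MonomialPair G} (h : P ≈ Q) : P.map β ≈ Q.map β := by
  obtain ⟨g, rfl⟩ := h
  exact ⟨β g, by ext x; simp [MonomialPair.val_map]⟩

/-- The action of `Aut(G)` on conjugacy classes, `β · [H, φ]_G = [β(H), φ ∘ β⁻¹]_G`. -/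
def autClass (β : MulAut G) : MonomialClass G → MonomialClass G :=
  Quotient.map (MonomialPair.map β) fun _ _ h => map_conj β h

/-- The representation of `Aut(G)` on `ℂ ⊗ B^{ℂˣ}(G)` by `β ↦ Iso(β)`. -/
def autRep (G : Type u) [Group G] : Representation ℂ (MulAut G) (MonBurnside G) where
  toFun β := Finsupp.lmapDomain ℂ ℂ (autClass β)
  map_one' := by
    have h : autClass (1 : MulAut G) = id := by
      funext c
      induction c using Quotient.inductionOn with
      | h P => exact congrArg (Quotient.mk _) (by ext x; simp only [MonomialPair.val_map]; rfl)
    rw [h, Finsupp.lmapDomain_id]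
    rfl
  map_mul' β γ := by
    have h : autClass (β * γ) = autClass β ∘ autClass γ := by
      funext c
      induction c using Quotient.inductionOn with
      | h P => exact congrArg (Quotient.mk _) (by ext x; simp only [MonomialPair.val_map]; rfl)
    rw [h, Finsupp.lmapDomain_comp]
    rfl

variable (U : Type u) [MulAction H U] [MulAction Gᵐᵒᵖ U] [SMulCommClass H Gᵐᵒᵖ U]

/-- For `u` in an `(H, G)`-biset `U` and a pair `(K, ψ)` of `G`: the `ℂˣ`-orbit of `u ⊗ 1` in
`U ×_G (G ×_K ℂ_ψˣ) = U ×_K ℂ_ψˣ` is free, i.e. `ψ` is trivial on `{k ∈ K | u k = u}`. -/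
def FreeAt (P : MonomialPair G) (u : U) : Prop :=
  ∀ k ∈ P.sub, MulOpposite.op k • u = u → P.val k = 1

variable {U}

theorem val_eq_of_smul_eq {P : MonomialPair G} {u : U} (hf : FreeAt U P u) {k l : G}
    (hk : k ∈ P.sub) (hl : l ∈ P.sub)
    (h : MulOpposite.op k • u = MulOpposite.op l • u) : P.val k = P.val l := by
  have h1 : P.val (k * l⁻¹) = 1 := by
    refine hf _ (P.sub.mul_mem hk (P.sub.inv_mem hl)) ?_
    rw [MulOpposite.op_mul, mul_smul, h, ← mul_smul, ← MulOpposite.op_mul]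
    simp
  have h2 := P.val_mul (P.sub.mul_mem hk (P.sub.inv_mem hl)) hl
  simpa [h1] using h2

/-- If the `ℂˣ`-orbit of `u ⊗ 1` is free, its stabilizing pair: the subgroup
`{h ∈ H | h u ∈ u K}` with the character sending `h` to `ψ(k)`, where `h u = u k`. -/
def bisetPair (P : MonomialPair G) (u : U) (hf : FreeAt U P u) : MonomialPair H where
  sub :=
    { carrier := {h | ∃ k ∈ P.sub, h • u = MulOpposite.op k • u}
      one_mem' := ⟨1, P.sub.one_mem, by simp⟩
      mul_mem' := by
        rintro a b ⟨k, hk, ha⟩ ⟨l, hl, hb⟩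
        exact ⟨k * l, P.sub.mul_mem hk hl, by
          rw [mul_smul, hb, smul_comm, ha, ← mul_smul, ← MulOpposite.op_mul]⟩
      inv_mem' := by
        rintro a ⟨k, hk, ha⟩
        refine ⟨k⁻¹, P.sub.inv_mem hk, ?_⟩
        rw [inv_smul_eq_iff, smul_comm, ha, ← mul_smul, ← MulOpposite.op_mul]
        simp }
  char := MonoidHom.mk' (fun h => P.char ⟨h.2.choose, h.2.choose_spec.1⟩) (by
    intro a b
    have hk := a.2.choose_spec
    have hl := b.2.choose_spec
    have hm := (a * b).2.choose_spec
    have key := val_eq_of_smul_eq hf hm.1 (P.sub.mul_mem hk.1 hl.1) (by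
      refine hm.2.symm.trans ?_
      change ((a : H) * (b : H)) • u = _
      rw [mul_smul, MulOpposite.op_mul, mul_smul]
      refine (congrArg ((a : H) • ·) hl.2).trans ?_
      rw [smul_comm]
      exact congrArg _ hk.2)
    rw [P.val_mul hk.1 hl.1, P.val_of_mem hm.1, P.val_of_mem hk.1, P.val_of_mem hl.1,
      ← Units.val_mul] at key
    exact Units.ext key)

theorem mem_bisetPair_sub (P : MonomialPair G) (u : U) (hf : FreeAt U P u) (h : H) :
    h ∈ (bisetPair (H := H) P u hf).sub ↔ ∃ k ∈ P.sub, h • u = MulOpposite.op k • u :=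
  Iff.rfl

theorem bisetPair_val (P : MonomialPair G) (u : U) (hf : FreeAt U P u) {h : H} {k : G}
    (hk : k ∈ P.sub) (hu : h • u = MulOpposite.op k • u) :
    (bisetPair (H := H) P u hf).val h = P.val k := by
  have hm : h ∈ (bisetPair (H := H) P u hf).sub := ⟨k, hk, hu⟩
  rw [MonomialPair.val_of_mem _ hm]
  have hc := Exists.choose_spec hm
  change ((P.char ⟨Exists.choose hm, hc.1⟩ : ℂˣ) : ℂ) = _
  rw [← P.val_of_mem hc.1]
  exact val_eq_of_smul_eq hf hc.1 hk (hc.2.symm.trans hu)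

variable (H U)

/-- The double orbit `H u K` of `u`. -/
def doubleOrbit (K : Subgroup G) (u : U) : Set U :=
  {v | ∃ h : H, ∃ k ∈ K, v = h • MulOpposite.op k • u}

open Classical in
/-- The class of `U ⊗_G X` for the transitive monomial `G`-set `X` with stabilizing pair
`P = (K, ψ)`, as in the composition of fibered bisets: `U ×_G X = U ×_K ℂ_ψˣ` with its non-free
`ℂˣ`-orbits removed. Its `ℂˣ`-orbits are indexed by `U / K`, hence
`U · [K, ψ]_G = ∑_{u ∈ [H \ U / K], u free} [{h | h u ∈ u K}, h ↦ ψ(k) if h u = u k]_H`.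
The sum over representatives of the `(H, K)`-orbits on `U` is written as the sum over all `u ∈ U`
of the terms divided by the length of the orbit. -/
def bisetPairAct (P : MonomialPair G) : MonBurnside H :=
  ∑ᶠ u : U, if hf : FreeAt U P u then
    ((doubleOrbit H U P.sub u).ncard : ℂ)⁻¹ • basisElt (bisetPair (H := H) P u hf) else 0

theorem bisetPairAct_conj {P Q : MonomialPair G} (h : P ≈ Q) :
    bisetPairAct H U P = bisetPairAct H U Q := by
  classical
  obtain ⟨a, rfl⟩ := h
  unfold bisetPairAct
  symm
  rw [← finsum_comp_equiv (MulAction.toPerm (MulOpposite.op a⁻¹) : Equiv.Perm U)]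
  refine finsum_congr fun u => ?_
  have hsm : ∀ k : G, MulOpposite.op k • MulOpposite.op a⁻¹ • u =
      MulOpposite.op a⁻¹ • MulOpposite.op (a⁻¹ * k * a) • u := by
    intro k
    rw [← mul_smul, ← mul_smul, ← MulOpposite.op_mul, ← MulOpposite.op_mul]
    simp [mul_assoc]
  have hmem : ∀ k : G, k ∈ (P.map (MulAut.conj a)).sub ↔ a⁻¹ * k * a ∈ P.sub := by
    intro k
    simp [MonomialPair.mem_map_sub]
  have hval : ∀ k : G, (P.map (MulAut.conj a)).val k = P.val (a⁻¹ * k * a) := by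
    intro k
    simp [MonomialPair.val_map]
  have hfree : FreeAt U (P.map (MulAut.conj a)) (MulOpposite.op a⁻¹ • u) ↔ FreeAt U P u := by
    constructor
    · intro hf k hk hu
      have := hf (a * k * a⁻¹) ((hmem _).2 (by simpa [mul_assoc] using hk))
        (by rw [hsm]; simpa [mul_assoc] using hu)
      rw [hval] at this
      simpa [mul_assoc] using this
    · intro hf k hk hu
      rw [hsm] at hu
      rw [hval]
      exact hf _ ((hmem k).1 hk) (smul_left_cancel _ hu)
  have horb : doubleOrbit H U (P.map (MulAut.conj a)).sub (MulOpposite.op a⁻¹ • u) =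
      MulAction.toPerm (MulOpposite.op a⁻¹) '' doubleOrbit H U P.sub u := by
    ext v
    constructor
    · rintro ⟨h, k, hk, rfl⟩
      exact ⟨_, ⟨h, _, (hmem k).1 hk, rfl⟩, by
        rw [hsm, MulAction.toPerm_apply, ← smul_comm h (MulOpposite.op a⁻¹)]⟩
    · rintro ⟨_, ⟨h, k, hk, rfl⟩, rfl⟩
      refine ⟨h, a * k * a⁻¹, (hmem _).2 (by simpa [mul_assoc] using hk), ?_⟩
      rw [hsm, MulAction.toPerm_apply, ← smul_comm h (MulOpposite.op a⁻¹)]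
      simp [mul_assoc]
  change (if hf : FreeAt U (P.map (MulAut.conj a)) (MulOpposite.op a⁻¹ • u) then
    ((doubleOrbit H U (P.map (MulAut.conj a)).sub (MulOpposite.op a⁻¹ • u)).ncard : ℂ)⁻¹ •
      basisElt (bisetPair (H := H) _ _ hf) else 0) = _
  by_cases hf : FreeAt U P u
  · have hf' := hfree.2 hf
    rw [dif_pos hf, dif_pos hf', horb, Set.ncard_image_of_injective _ (Equiv.injective _)]
    congr 2
    ext x
    symm
    by_cases hx : ∃ k ∈ P.sub, x • u = MulOpposite.op k • u
    · obtain ⟨k, hk, hxu⟩ := hx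
      rw [bisetPair_val P u hf hk hxu,
        bisetPair_val (k := a * k * a⁻¹) _ _ hf' ((hmem _).2 (by simpa [mul_assoc] using hk)) (by
          rw [hsm, smul_comm, hxu]; simp [mul_assoc]), hval]
      simp [mul_assoc]
    · have h1 : x ∉ (bisetPair (H := H) P u hf).sub := hx
      have h2 : x ∉ (bisetPair (H := H) (P.map (MulAut.conj a)) _ hf').sub := by
        rintro ⟨k, hk, hxu⟩
        rw [hsm, smul_comm] at hxu
        exact hx ⟨_, (hmem k).1 hk, smul_left_cancel _ hxu⟩
      rw [MonomialPair.val, MonomialPair.val, dif_neg h1, dif_neg h2]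
  · have hf' := mt hfree.1 hf
    rw [dif_neg hf, dif_neg hf']

/-- The map `ℂ ⊗ B^{ℂˣ}(G) → ℂ ⊗ B^{ℂˣ}(H)` induced by a finite `(H, G)`-biset `U` (a left `H`-set
and right `G`-set with commuting actions). -/
def bisetAct : MonBurnside G →ₗ[ℂ] MonBurnside H :=
  Finsupp.linearCombination ℂ
    (Quotient.lift (bisetPairAct H U) fun _ _ h => bisetPairAct_conj H U h)

end Biset

/-! ### The functor `𝕊_p`, restriction kernels, deflation and the idempotent `ẽ_G^G` -/

/-- The evaluation at `G` of `𝕊_p`, the kernel of the linearization map. -/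
def kerLin (G : Type u) [Group G] : Submodule ℂ (MonBurnside G) :=
  LinearMap.ker (lin G)

/-- The restriction kernel of `𝕊_p` at `G`: all elements of `𝕊_p(G)` annihilated by every finite
`(H, G)`-biset with `H` a finite `p`-group of order smaller than `|G|` (by linearity, by every
element of `ℂB(H, G)`). -/
def restrictionKernel (p : ℕ) (G : Type u) [Group G] : Submodule ℂ (MonBurnside G) where
  carrier := {x | x ∈ kerLin G ∧
    ∀ (H : Type u) [Group H] [Finite H], IsPGroup p H → Nat.card H < Nat.card G →
      ∀ (U : Type u) [Finite U] [MulAction H U] [MulAction Gᵐᵒᵖ U] [SMulCommClass H Gᵐᵒᵖ U],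
        bisetAct H U x = 0}
  zero_mem' := ⟨Submodule.zero_mem _, by intros; simp⟩
  add_mem' := by
    rintro x y ⟨hx, hx'⟩ ⟨hy, hy'⟩
    refine ⟨Submodule.add_mem _ hx hy, ?_⟩
    intro H _ _ hH hc U _ _ _ _
    rw [map_add, hx' H hH hc U, hy' H hH hc U, add_zero]
  smul_mem' := by
    rintro c x ⟨hx, hx'⟩
    refine ⟨Submodule.smul_mem _ c hx, ?_⟩
    intro H _ _ hH hc U _ _ _ _
    rw [map_smul, hx' H hH hc U, smul_zero]

section Def

variable {G : Type u} [Group G]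

/-- The underlying set of the `(G/N, G)`-biset `Def^G_{G/N}`. -/
def DefBiset (N : Subgroup G) : Type u := G ⧸ N

instance (N : Subgroup G) [N.Normal] : MulAction (G ⧸ N) (DefBiset N) :=
  inferInstanceAs (MulAction (G ⧸ N) (G ⧸ N))

/-- The right action `(xN) · g = xgN`. -/
instance (N : Subgroup G) [N.Normal] : MulAction Gᵐᵒᵖ (DefBiset N) where
  smul g := fun (x : G ⧸ N) => (x * QuotientGroup.mk g.unop : G ⧸ N)
  one_smul := fun (x : G ⧸ N) => mul_one x
  mul_smul a b := fun (x : G ⧸ N) =>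
    (mul_assoc x (QuotientGroup.mk b.unop) (QuotientGroup.mk a.unop)).symm

instance (N : Subgroup G) [N.Normal] : SMulCommClass (G ⧸ N) Gᵐᵒᵖ (DefBiset N) where
  smul_comm a b := fun (x : G ⧸ N) => (mul_assoc a x (QuotientGroup.mk b.unop)).symm

/-- The deflation map `Def^G_{G/N}`. -/
def deflation (N : Subgroup G) [N.Normal] : MonBurnside G →ₗ[ℂ] MonBurnside (G ⧸ N) :=
  bisetAct (G ⧸ N) (DefBiset N)

/-- The underlying set of the `(G, G)`-biset `G × X` attached to a `G`-set `X`, with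
`a · (g, x) · b = (agb, ax)`. For `X = G/K` it is `(G × G)/Δ(K) = Ind_K^G ∘ Res_K^G`. -/
def TildeBiset (G X : Type u) : Type u := G × X

instance (X : Type u) [MulAction G X] : MulAction G (TildeBiset G X) :=
  inferInstanceAs (MulAction G (G × X))

instance (X : Type u) : MulAction Gᵐᵒᵖ (TildeBiset G X) where
  smul b y := (y.1 * b.unop, y.2)
  one_smul y := Prod.ext (mul_one y.1) rfl
  mul_smul a b y := Prod.ext (mul_assoc y.1 b.unop a.unop).symm rfl

instance (X : Type u) [MulAction G X] : SMulCommClass G Gᵐᵒᵖ (TildeBiset G X) where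
  smul_comm a b y := Prod.ext (mul_assoc a y.1 b.unop).symm rfl

open Classical in
/-- The Möbius function `μ(K, G)` of the poset of subgroups of the finite group `G`. -/
def subgroupMoebius [Finite G] (K : Subgroup G) : ℂ :=
  letI : Fintype (Subgroup G) := Fintype.ofFinite _
  letI : LocallyFiniteOrder (Subgroup G) := Fintype.toLocallyFiniteOrder
  IncidenceAlgebra.mu ℂ K ⊤

variable (G) in
/-- The action of `ẽ_G^G`, the image in `ℂB(G, G)` under `X ↦ G × X` of the primitive idempotent
`e_G^G = |G|⁻¹ ∑_{K ≤ G} |K| μ(K, G) [G/K]` of the Burnside algebra `ℂB(G)`. -/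
def eTilde [Finite G] : MonBurnside G →ₗ[ℂ] MonBurnside G :=
  (Nat.card G : ℂ)⁻¹ • ∑ᶠ K : Subgroup G,
    ((Nat.card K : ℂ) * subgroupMoebius K) • bisetAct G (TildeBiset G (G ⧸ K))

variable (G) in
/-- The subspace `ẽ_G^G 𝕊_p(G)`. -/
def eTildeKerLin [Finite G] : Submodule ℂ (MonBurnside G) :=
  (kerLin G).map (eTilde G)

end Def

/-! ### Cyclic groups -/

section Cyclic

variable {G : Type u} [Group G]

/-- Every subgroup of a cyclic group is stable under all automorphisms. -/
instance characteristic_of_isCyclic [IsCyclic G] (H : Subgroup G) : H.Characteristic := by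
  refine Subgroup.characteristic_iff_map_le.2 fun β => ?_
  obtain ⟨n, hn⟩ := MonoidHom.map_cyclic β.toMonoidHom
  rintro _ ⟨x, hx, rfl⟩
  rw [hn]
  exact H.zpow_mem hx n

/-- For subgroups `H, Z ≤ G`, the group `Aut_Z(H)` of all automorphisms of `H` that induce
the identity modulo `Z`, i.e. with `x⁻¹ α(x) ∈ Z` for all `x ∈ H`. -/
def autMod (H Z : Subgroup G) : Subgroup (MulAut H) where
  carrier := {α | ∀ x : H, (x : G)⁻¹ * (α x : G) ∈ Z}
  one_mem' := by intro x; simp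
  mul_mem' := by
    intro a b ha hb x
    have h := Z.mul_mem (hb x) (ha (b x))
    simpa [mul_assoc] using h
  inv_mem' := by
    intro a ha x
    have h := Z.inv_mem (ha (a⁻¹ x))
    simpa [mul_assoc] using h

/-- `e_{G,l,φ} = ∑_{α ∈ Aut(H_l)} φ(α⁻¹) e_{G, α(h_l)}^G` with `H_l = ⟨h_l⟩`. -/
def eChar (h : G) (φ : MulAut (Subgroup.zpowers h) →* ℂˣ) : MonBurnside G :=
  ∑ᶠ α : MulAut (Subgroup.zpowers h),
    (φ α⁻¹ : ℂ) • primIdem (⊤ : Subgroup G) (α ⟨h, Subgroup.mem_zpowers h⟩ : G)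

/-- The one-dimensional representation with character `χ`. -/
def charRep {A : Type u} [Group A] (χ : A →* ℂˣ) : Representation ℂ A ℂ :=
  (Algebra.lmul ℂ ℂ).toMonoidHom.comp ((Units.coeHom ℂ).comp χ)

/-- A character of `Aut(G)`, `G` cyclic of order `n`, is primitive if it is primitive as a
Dirichlet character modulo `n` via the canonical isomorphism `Aut(G) ≅ (ℤ/n)ˣ`. -/
def IsPrimitiveChar [IsCyclic G] (χ : MulAut G →* ℂˣ) : Prop :=
  DirichletCharacter.IsPrimitive
    (MulChar.ofUnitHom (χ.comp (IsCyclic.mulAutMulEquiv G).symm.toMonoidHom) :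
      DirichletCharacter ℂ (Nat.card G))

end Cyclic

end MonomialBurnside

end

open MonomialBurnside

noncomputable section

namespace MonomialBurnside

open MonomialPair

/-! ### Characters of finite commutative groups -/

section Characters

variable {A : Type*} [Group A] [Finite A] [IsMulCommutative A]

/-! Let M be the unique maximal and Z the unique minimal subgroup of G. Species separate the points
of the monomial Burnside algebra of an abelian group (`eq_zero_of_species_eq_zero`). The idempotent
ẽ_G^G keeps the species at G and kills those at proper subgroups, so its image is the space of
functions g ↦ s_{G,g}(x) on G. An element outside M generates G, where s_{G,g} is a value of the
linearization; hence ẽ_G^G 𝕊_p(G) consists of the functions supported on M (`mem_eTildeKerLin_iff`).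

The functions on G have two useful bases: the delta functions, which are the e_{G,g}, and the
characters ψ of G, which are the elements ẽ_G^G[G,ψ] = `topTerm M ψ`. Bisets are transparent in the
second. If ψ is nontrivial on Z, every biset to a smaller group kills `topTerm M ψ`
(`bisetAct_topTerm_eq_zero`); if ψ is trivial on Z, deflation to G/Z remembers ψ
(`species_top_deflation_topTerm`). Since vanishing under restriction to M forces an element into the
image of ẽ_G^G, the restriction kernel is the space of functions supported on M with sum zero over
every coset of Z (`mem_restrictionKernel_iff`).

The element e_{G,l,φ} is the function α(h_l) ↦ φ(α⁻¹) on the elements of order p^l. For l ≥ 2 these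
are a union of cosets of Z, each an orbit of Aut_Z(H_l), so its coset sums are multiples of the sum
of φ over this group of order p; they vanish iff φ is nontrivial there. For l ≤ 1 everything lies in
the coset Z, with total 0 if φ ≠ 1, p - 1 for e_{G,1,1} and 1 for e_{G,0,1}; this explains the last
basis vector. The other e_{G,l,φ} with l ≠ 1 are constant on cosets outside Z and vanish on Z \ {1},
and such a function with zero coset sums is 0; this yields spanning (`span_kernelFamily`).

Finally, Aut(G) acts on each basis vector through a character χ inflated from Aut(H_l), and the
condition on φ says that l is the least level with χ trivial on the stabilizer of h_l (the last
vector has χ = 1 and l = 0). The characters trivial on the stabilizer of h_{k-1} are the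
non-primitive ones, and each arises once (`kernelChar_injective`, `range_kernelChar`). Distinctness
of the characters also gives linear independence. -/

open scoped IsMulCommutative in
theorem exists_char_apply_ne_one {a : A} (ha : a ≠ 1) : ∃ φ : A →* ℂˣ, φ a ≠ 1 :=
  CommGroup.exists_apply_ne_one_of_hasEnoughRootsOfUnity A ℂ ha

open scoped IsMulCommutative in
theorem nonempty_char_equiv : Nonempty ((A →* ℂˣ) ≃ A) :=
  (CommGroup.monoidHom_mulEquiv_of_hasEnoughRootsOfUnity A ℂ).map MulEquiv.toEquiv

instance finite_char : Finite (A →* ℂˣ) :=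
  Finite.of_equiv A nonempty_char_equiv.some.symm

theorem sum_char_apply_of_ne_one [Fintype (A →* ℂˣ)] {a : A} (ha : a ≠ 1) :
    ∑ φ : A →* ℂˣ, (φ a : ℂ) = 0 := by
  obtain ⟨χ, hχ⟩ := exists_char_apply_ne_one ha
  have h : (χ a : ℂ) * ∑ φ : A →* ℂˣ, (φ a : ℂ) = ∑ φ : A →* ℂˣ, (φ a : ℂ) := by
    rw [Finset.mul_sum]
    exact Fintype.sum_equiv (Equiv.mulLeft χ) _ _ fun φ => by simp
  have h1 : (χ a : ℂ) - 1 ≠ 0 := fun h0 => hχ (Units.ext (by simpa [sub_eq_zero] using h0))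
  refine (mul_eq_zero.1 (?_ : ((χ a : ℂ) - 1) * _ = 0)).resolve_left h1
  rw [sub_mul, h, one_mul, sub_self]

theorem sum_char_one [Fintype (A →* ℂˣ)] :
    ∑ φ : A →* ℂˣ, (φ 1 : ℂ) = Nat.card A := by
  simp [← Nat.card_congr (nonempty_char_equiv (A := A)).some, Nat.card_eq_fintype_card]


open Classical in
theorem sum_char_div [Fintype (A →* ℂˣ)] (a b : A) :
    ∑ φ : A →* ℂˣ, (φ a⁻¹ : ℂ) * (φ b : ℂ) = if a = b then (Nat.card A : ℂ) else 0 := by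
  have h : ∀ φ : A →* ℂˣ, (φ a⁻¹ : ℂ) * (φ b : ℂ) = (φ (a⁻¹ * b) : ℂ) := by simp
  simp_rw [h]
  split_ifs with hab
  · subst hab
    rw [inv_mul_cancel, sum_char_one]
  · exact sum_char_apply_of_ne_one fun h => hab (by simpa [inv_mul_eq_one] using h)

open Classical in
theorem sum_char_mul_inv [Fintype (A →* ℂˣ)] (a b : A) :
    ∑ φ : A →* ℂˣ, (φ b : ℂ) * (φ a⁻¹ : ℂ) = if a = b then (Nat.card A : ℂ) else 0 := by
  rw [← sum_char_div]
  exact Finset.sum_congr rfl fun φ _ => mul_comm _ _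

end Characters

theorem sum_apply_of_ne_one {A : Type*} [Group A] [Fintype A] {φ : A →* ℂˣ} (hφ : φ ≠ 1) :
    ∑ a, (φ a : ℂ) = 0 := by
  obtain ⟨w, hw⟩ := DFunLike.ne_iff.1 hφ
  have h : (φ w : ℂ) * ∑ a, (φ a : ℂ) = ∑ a, (φ a : ℂ) := by
    rw [Finset.mul_sum]
    exact Fintype.sum_equiv (Equiv.mulLeft w) _ _ fun a => by simp
  have h1 : (φ w : ℂ) - 1 ≠ 0 := fun h0 => hw (Units.ext (by simpa [sub_eq_zero] using h0))
  refine (mul_eq_zero.1 (?_ : ((φ w : ℂ) - 1) * _ = 0)).resolve_left h1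
  rw [sub_mul, h, one_mul, sub_self]

theorem sum_apply_subgroup_of_ne_one {A : Type*} [Group A] {Z : Subgroup A} [Fintype Z]
    {φ : A →* ℂˣ} {w : A} (hw : w ∈ Z) (hφ : φ w ≠ 1) : ∑ z : Z, (φ z : ℂ) = 0 :=
  sum_apply_of_ne_one (φ := φ.comp Z.subtype) fun h => hφ (DFunLike.congr_fun h ⟨w, hw⟩)

theorem linearIndependent_char (A : Type*) [Group A] :
    LinearIndependent ℂ fun (φ : A →* ℂˣ) (a : A) => (φ a : ℂ) := by
  refine (linearIndependent_monoidHom A ℂ).comp (fun φ : A →* ℂˣ => (Units.coeHom ℂ).comp φ) ?_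
  intro φ ψ h
  ext a
  exact DFunLike.congr_fun h a

/-- Dedekind independence in coefficient form, the tool for isolating the coefficient of a single
character. -/
theorem eq_zero_of_sum_char_eq_zero {A : Type*} [Group A] [Fintype (A →* ℂˣ)]
    {c : (A →* ℂˣ) → ℂ} (h : ∀ a, ∑ φ, c φ * (φ a : ℂ) = 0) (φ : A →* ℂˣ) : c φ = 0 := by
  refine Fintype.linearIndependent_iff.1 (linearIndependent_char A) c ?_ φ
  funext a
  simpa using h a

/-! ### Values of the structure maps on basis elements -/

section Basis

variable {G : Type u} [Group G]

theorem linearMap_ext_basisElt {V : Type*} [AddCommMonoid V] [Module ℂ V]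
    {f g : MonBurnside G →ₗ[ℂ] V} (h : ∀ P, f (basisElt P) = g (basisElt P)) : f = g := by
  refine Finsupp.lhom_ext' fun c => LinearMap.ext_ring ?_
  induction c using Quotient.inductionOn with
  | h P => exact h P

@[simp]
theorem lin_basisElt (P : MonomialPair G) : lin G (basisElt P) = indChar P := by
  simp [lin, basisElt]

@[simp]
theorem species_basisElt (H : Subgroup G) (h : G) (P : MonomialPair G) :
    species H h (basisElt P) = speciesPair H h P := by
  simp [species, basisElt]

@[simp]
theorem bisetAct_basisElt (H : Type u) [Group H] (U : Type u) [MulAction H U] [MulAction Gᵐᵒᵖ U]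
    [SMulCommClass H Gᵐᵒᵖ U] (P : MonomialPair G) :
    bisetAct H U (basisElt P) = bisetPairAct H U P := by
  simp [bisetAct, basisElt]

@[simp]
theorem autRep_basisElt (β : MulAut G) (P : MonomialPair G) :
    autRep G β (basisElt P) = basisElt (P.map β) :=
  Finsupp.mapDomain_single

theorem val_of_notMem (P : MonomialPair G) {g : G} (h : g ∉ P.sub) : P.val g = 0 := by
  simp [val, h]

theorem val_one (P : MonomialPair G) : P.val 1 = 1 := by
  rw [val_of_mem _ P.sub.one_mem, show P.char ⟨1, P.sub.one_mem⟩ = 1 from map_one P.char,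
    Units.val_one]

/-- The linearization is given by the species of cyclic subgroups. -/
theorem lin_apply_eq_species (x : MonBurnside G) (g : G) :
    lin G x g = species (Subgroup.zpowers g) g x := by
  have : (LinearMap.proj g).comp (lin G) = species (Subgroup.zpowers g) g := by
    refine linearMap_ext_basisElt fun P => ?_
    rw [LinearMap.comp_apply, lin_basisElt, species_basisElt, LinearMap.proj_apply, indChar,
      speciesPair]
    congr 1
    refine finsum_congr fun x => ?_
    split_ifs with h
    · rfl
    · refine val_of_notMem _ fun hx => h fun y hy => ?_
      obtain ⟨n, rfl⟩ := Subgroup.mem_zpowers_iff.1 hy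
      have := P.sub.zpow_mem hx n
      rwa [show x⁻¹ * g * x = x⁻¹ * g * x⁻¹⁻¹ by simp, conj_zpow, inv_inv] at this
  exact LinearMap.congr_fun this x

/-- The pair `(K, ψ|_K)` for a character `ψ` of `G`. -/
def resPair (ψ : G →* ℂˣ) (K : Subgroup G) : MonomialPair G := ⟨K, ψ.comp K.subtype⟩

theorem val_resPair_of_mem (ψ : G →* ℂˣ) {K : Subgroup G} {g : G} (h : g ∈ K) :
    (resPair ψ K).val g = ψ g :=
  val_of_mem _ h

end Basis

/-! ### Commutative groups -/

section Commutative

variable {G : Type u} [Group G] [IsMulCommutative G]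

theorem conj_cancel (x y : G) : x⁻¹ * y * x = y := by
  rw [mul_comm' x⁻¹ y, inv_mul_cancel_right]

theorem eq_of_equiv {P Q : MonomialPair G} (h : P ≈ Q) : P = Q := by
  obtain ⟨g, rfl⟩ := h
  ext x
  rw [val_map, MulAut.conj_symm_apply, conj_cancel]

open Classical in
-- Conjugation is trivial, so all cosets contribute the same term and the sum is the index times one
-- value.
theorem speciesPair_eq [Finite G] (H : Subgroup G) (h : G) (P : MonomialPair G) :
    speciesPair H h P = if H ≤ P.sub then (Nat.card G / Nat.card P.sub : ℂ) * P.val h else 0 := by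
  have := Fintype.ofFinite G
  rw [speciesPair, finsum_eq_sum_of_fintype]
  simp_rw [conj_cancel]
  rw [Finset.sum_const, Finset.card_univ, ← Nat.card_eq_fintype_card, SetLike.le_def]
  split_ifs with h1
  · rw [nsmul_eq_mul]
    ring
  · simp

instance [Finite G] : Finite (MonomialPair G) :=
  Finite.of_injective (fun P => (⟨P.sub, P.char⟩ : Σ K : Subgroup G, K →* ℂˣ)) (by
    rintro ⟨H, φ⟩ ⟨K, ψ⟩ h
    cases h
    rfl)

/-- The species of a finite commutative group separate points. -/
theorem eq_zero_of_species_eq_zero [Finite G] {x : MonBurnside G}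
    (hx : ∀ (K : Subgroup G) (k : G), k ∈ K → species K k x = 0) : x = 0 := by
  classical
  suffices h : ∀ (K : Subgroup G) (ψ : K →* ℂˣ), x (Quotient.mk _ ⟨K, ψ⟩) = 0 by
    ext c
    induction c using Quotient.inductionOn with
    | h P => exact h P.sub P.char
  intro K
  -- Descending induction. Pairs over subgroups strictly above K have coefficient 0 already, and
  -- those over subgroups not containing K are invisible to s_{K,k}; what remains is a vanishing
  -- combination of characters of K.
  induction K using WellFoundedGT.induction with
  | ind K ih =>
  have := Fintype.ofFinite (MonomialClass G)
  have := Fintype.ofFinite (K →* ℂˣ)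
  intro ψ
  refine eq_zero_of_sum_char_eq_zero (c := fun ψ : K →* ℂˣ => x (Quotient.mk _ ⟨K, ψ⟩))
    (fun k => ?_) ψ
  have hk := hx K k k.2
  rw [species, Finsupp.linearCombination_apply, Finsupp.sum_fintype _ _ (by simp)] at hk
  have hinj : Function.Injective fun ψ : K →* ℂˣ =>
      (Quotient.mk _ ⟨K, ψ⟩ : MonomialClass G) := by
    intro ψ ψ' h
    cases eq_of_equiv (Quotient.exact h)
    rfl
  have hz : (Nat.card G / Nat.card K : ℂ) ≠ 0 :=
    div_ne_zero (Nat.cast_ne_zero.2 Nat.card_pos.ne') (Nat.cast_ne_zero.2 Nat.card_pos.ne')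
  refine (mul_eq_zero.1 (?_ : (Nat.card G / Nat.card K : ℂ) * _ = 0)).resolve_left hz
  rw [← hk, Finset.mul_sum]
  refine Fintype.sum_of_injective _ hinj _ _ (fun c hc => ?_) fun ψ => ?_
  · induction c using Quotient.inductionOn with
    | h P =>
    rw [Quotient.lift_mk, speciesPair_eq]
    split_ifs with hKP
    · rcases hKP.eq_or_lt with h | h
      · obtain ⟨L, ψ⟩ := P
        obtain rfl : K = L := h
        exact absurd ⟨ψ, rfl⟩ hc
      · rw [ih P.sub h P.char, zero_smul]
    · simp
  · rw [Quotient.lift_mk, speciesPair_eq, if_pos le_rfl, val_of_mem _ k.2]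
    simp only [smul_eq_mul]
    ring

theorem ext_species [Finite G] {x y : MonBurnside G}
    (h : ∀ (K : Subgroup G) (k : G), k ∈ K → species K k x = species K k y) : x = y :=
  sub_eq_zero.1 (eq_zero_of_species_eq_zero fun K k hk => by rw [map_sub, h K k hk, sub_self])

end Commutative

/-! ### Primitive idempotents at the whole group -/

section TopTerm

variable {G : Type u} [Group G]

/-- The element `[G, ψ] - |G : M|⁻¹ [M, ψ|_M]`. -/
def topTerm (M : Subgroup G) (ψ : G →* ℂˣ) : MonBurnside G :=
  basisElt (resPair ψ ⊤) - (Nat.card M / Nat.card G : ℂ) • basisElt (resPair ψ M)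

theorem exists_eq_resPair_top {P : MonomialPair G} (h : P.sub = ⊤) :
    ∃ ψ : G →* ℂˣ, P = resPair ψ ⊤ := by
  obtain ⟨K, φ⟩ := P
  obtain rfl : K = ⊤ := h
  refine ⟨φ.comp Subgroup.topEquiv.symm.toMonoidHom, ?_⟩
  ext g
  rw [val_resPair_of_mem _ (Subgroup.mem_top g), val_of_mem _ (Subgroup.mem_top g)]
  rfl

variable [IsMulCommutative G] [Finite G]

theorem cast_card_ne_zero (A : Type*) [Nonempty A] [Finite A] : (Nat.card A : ℂ) ≠ 0 :=
  Nat.cast_ne_zero.2 Nat.card_pos.ne'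

theorem species_top_resPair_top (g : G) (ψ : G →* ℂˣ) :
    species ⊤ g (basisElt (resPair ψ ⊤)) = ψ g := by
  classical
  rw [species_basisElt, speciesPair_eq, if_pos (show ⊤ ≤ (resPair ψ ⊤).sub from le_top),
    val_resPair_of_mem _ (Subgroup.mem_top g)]
  have h3 : Nat.card (resPair ψ ⊤).sub = Nat.card G := Subgroup.card_top
  rw [h3, div_self (cast_card_ne_zero G), one_mul]

open Classical in
-- On subgroups of M the species of [M, ψ|_M] carry the factor |G : M|, which the coefficient in
-- `topTerm` cancels. The hypothesis `hM`, kept throughout, says that M is the only maximal subgroup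
-- and contains every proper one.
theorem species_topTerm {M : Subgroup G} (hM : ∀ K : Subgroup G, K ≤ M ↔ K ≠ ⊤) (ψ : G →* ℂˣ)
    {K : Subgroup G} {k : G} (hk : k ∈ K) :
    species K k (topTerm M ψ) = if K = ⊤ then (ψ k : ℂ) else 0 := by
  have h1 := cast_card_ne_zero G
  have h2 := cast_card_ne_zero M
  rw [topTerm, map_sub, map_smul, species_basisElt, species_basisElt, speciesPair_eq,
    speciesPair_eq, if_pos (show K ≤ (resPair ψ ⊤).sub from le_top),
    val_resPair_of_mem _ (Subgroup.mem_top k)]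
  have h3 : Nat.card (resPair ψ ⊤).sub = Nat.card G := Subgroup.card_top
  have h4 : (resPair ψ M).sub = M := rfl
  rw [h3, h4, hM]
  by_cases hK : K = ⊤
  · simp [hK, h1]
  · rw [if_pos hK, if_neg hK, val_resPair_of_mem _ ((hM K).2 hK hk)]
    simp only [smul_eq_mul]
    field_simp
    ring

omit [Finite G] in
theorem pairConj_top_iff {g : G} {K : Subgroup G} {k : G} :
    PairConj ⊤ g K k ↔ K = ⊤ ∧ g = k := by
  have hK : ⁅K, K⁆ = ⊥ := by
    rw [eq_bot_iff, Subgroup.commutator_le]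
    intro a _ b _
    rw [Subgroup.mem_bot, commutatorElement_eq_one_iff_mul_comm, mul_comm']
  have h : ∀ a : G, a * g * a⁻¹ = g := fun a => by rw [mul_comm' a, mul_inv_cancel_right]
  simp only [PairConj, hK, Subgroup.mem_bot, h, mul_inv_eq_one]
  constructor
  · rintro ⟨a, h1, h2⟩
    refine ⟨?_, h2⟩
    rw [← h1]
    exact Subgroup.map_top_of_surjective _ (MulAut.conj a).surjective
  · rintro ⟨h1, h2⟩
    refine ⟨1, ?_, h2⟩
    rw [h1]
    exact Subgroup.map_top_of_surjective _ (MulAut.conj (1 : G)).surjective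

/-- Fourier inversion: on G the term of ψ is the function ψ, and the delta function at g is the
average of ψ(g)⁻¹ψ. -/
theorem isPrimIdem_sum_topTerm [Fintype (G →* ℂˣ)] {M : Subgroup G}
    (hM : ∀ K : Subgroup G, K ≤ M ↔ K ≠ ⊤) (g : G) :
    IsPrimIdem ⊤ g ((Nat.card G : ℂ)⁻¹ • ∑ ψ : G →* ℂˣ, (ψ g⁻¹ : ℂ) • topTerm M ψ) := by
  classical
  intro K k hk
  rw [map_smul, map_sum]
  simp_rw [map_smul, species_topTerm hM _ hk, pairConj_top_iff]
  by_cases hK : K = ⊤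
  · simp only [hK, if_true, true_and, smul_eq_mul]
    rw [sum_char_div]
    have := cast_card_ne_zero G
    split_ifs <;> simp [this]
  · simp [hK]

/-- `primIdem` is a mere choice, so it has its defining property only once some element is known to
have it. -/
theorem primIdem_spec {M : Subgroup G} (hM : ∀ K : Subgroup G, K ≤ M ↔ K ≠ ⊤) (g : G) :
    IsPrimIdem ⊤ g (primIdem ⊤ g) := by
  have := Fintype.ofFinite (G →* ℂˣ)
  exact Classical.epsilon_spec ⟨_, isPrimIdem_sum_topTerm hM g⟩

theorem IsPrimIdem.unique {H : Subgroup G} {h : G} {x y : MonBurnside G} (hx : IsPrimIdem H h x)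
    (hy : IsPrimIdem H h y) : x = y :=
  ext_species fun K k hk => by rw [hx K k hk, hy K k hk]

open Classical in
theorem species_top_primIdem {M : Subgroup G} (hM : ∀ K : Subgroup G, K ≤ M ↔ K ≠ ⊤) (g k : G) :
    species ⊤ k (primIdem ⊤ g) = if g = k then 1 else 0 := by
  rw [primIdem_spec hM g ⊤ k (Subgroup.mem_top k)]
  simp [pairConj_top_iff]

/-! ### The ideal spanned by the primitive idempotents at the whole group -/

variable (G) in
/-- The elements on which all species of proper subgroups vanish. -/
def topSpace : Submodule ℂ (MonBurnside G) where
  carrier := {x | ∀ K : Subgroup G, K ≠ ⊤ → ∀ k ∈ K, species K k x = 0}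
  zero_mem' := fun K _ k _ => map_zero _
  add_mem' := fun {x y} hx hy K hK k hk => by rw [map_add, hx K hK k hk, hy K hK k hk, add_zero]
  smul_mem' := fun c x hx K hK k hk => by rw [map_smul, hx K hK k hk, smul_zero]

theorem primIdem_mem_topSpace {M : Subgroup G} (hM : ∀ K : Subgroup G, K ≤ M ↔ K ≠ ⊤)
    (g : G) : primIdem ⊤ g ∈ topSpace G := by
  intro K hK k hk
  rw [primIdem_spec hM g K k hk, if_neg]
  rw [pairConj_top_iff]
  exact fun h => hK h.1

theorem ext_topSpace {x y : MonBurnside G} (hx : x ∈ topSpace G) (hy : y ∈ topSpace G)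
    (h : ∀ g, species ⊤ g x = species ⊤ g y) : x = y := by
  refine ext_species fun K k hk => ?_
  by_cases hK : K = ⊤
  · rw [hK, h]
  · rw [hx K hK k hk, hy K hK k hk]

theorem eq_sum_primIdem [Fintype G] {M : Subgroup G} (hM : ∀ K : Subgroup G, K ≤ M ↔ K ≠ ⊤)
    {x : MonBurnside G} (hx : x ∈ topSpace G) : x = ∑ g, species ⊤ g x • primIdem ⊤ g := by
  classical
  refine ext_topSpace hx (Submodule.sum_mem _ fun g _ =>
    Submodule.smul_mem _ _ (primIdem_mem_topSpace hM g)) fun k => ?_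
  rw [map_sum]
  simp [species_top_primIdem hM]

theorem primIdem_eq [Fintype (G →* ℂˣ)] {M : Subgroup G}
    (hM : ∀ K : Subgroup G, K ≤ M ↔ K ≠ ⊤) (g : G) :
    primIdem ⊤ g = (Nat.card G : ℂ)⁻¹ • ∑ ψ : G →* ℂˣ, (ψ g⁻¹ : ℂ) • topTerm M ψ :=
  (primIdem_spec hM g).unique (isPrimIdem_sum_topTerm hM g)

/-- The change from delta functions to characters; the action of bisets is computed in the latter.
-/
theorem exists_eq_sum_topTerm [Fintype (G →* ℂˣ)] {M : Subgroup G}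
    (hM : ∀ K : Subgroup G, K ≤ M ↔ K ≠ ⊤) {x : MonBurnside G} (hx : x ∈ topSpace G) :
    ∃ a : (G →* ℂˣ) → ℂ, x = ∑ ψ, a ψ • topTerm M ψ := by
  have := Fintype.ofFinite G
  refine ⟨fun ψ => ∑ g, species ⊤ g x * (Nat.card G : ℂ)⁻¹ * (ψ g⁻¹ : ℂ), ?_⟩
  conv_lhs => rw [eq_sum_primIdem hM hx]
  simp_rw [primIdem_eq hM, Finset.sum_smul, Finset.smul_sum]
  rw [Finset.sum_comm]
  simp_rw [smul_smul, mul_assoc]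

theorem species_top_sum_topTerm [Fintype (G →* ℂˣ)] {M : Subgroup G}
    (hM : ∀ K : Subgroup G, K ≤ M ↔ K ≠ ⊤) (a : (G →* ℂˣ) → ℂ) (g : G) :
    species ⊤ g (∑ ψ, a ψ • topTerm M ψ) = ∑ ψ, a ψ * (ψ g : ℂ) := by
  rw [map_sum]
  simp [species_topTerm hM _ (Subgroup.mem_top g)]

end TopTerm

/-! ### Bisets all of whose points have the same stabilizing pair -/

section ConstBiset

variable {G H : Type u} [Group G] [Group H] {U : Type u} [MulAction H U] [MulAction Gᵐᵒᵖ U]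
  [SMulCommClass H Gᵐᵒᵖ U]

/-- Identifies the stabilizing pair without unfolding the choice of k in `bisetPair`. -/
theorem bisetPair_eq {P : MonomialPair G} {u : U} (hf : FreeAt U P u) {Q : MonomialPair H}
    (h1 : ∀ h ∈ Q.sub, ∃ k ∈ P.sub, h • u = MulOpposite.op k • u)
    (h2 : ∀ h, ∀ k ∈ P.sub, h • u = MulOpposite.op k • u → h ∈ Q.sub ∧ Q.val h = P.val k) :
    bisetPair P u hf = Q := by
  ext h
  by_cases hh : h ∈ Q.sub
  · obtain ⟨k, hk, hu⟩ := h1 h hh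
    rw [bisetPair_val P u hf hk hu, (h2 h k hk hu).2]
  · rw [val_of_notMem Q hh, val_of_notMem]
    rintro ⟨k, hk, hu⟩
    exact hh (h2 h k hk hu).1

/-- If all double orbits have n points, there are |U|/n of them, each contributing the same class.
-/
theorem bisetPairAct_of_const [Finite U] {P : MonomialPair G} {Q : MonomialPair H} {n : ℕ}
    (hf : ∀ u : U, FreeAt U P u) (hQ : ∀ u : U, bisetPair P u (hf u) = Q)
    (hn : ∀ u : U, (doubleOrbit H U P.sub u).ncard = n) :
    bisetPairAct H U P = (Nat.card U / n : ℂ) • basisElt Q := by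
  have := Fintype.ofFinite U
  rw [bisetPairAct, finsum_eq_sum_of_fintype]
  simp_rw [dif_pos (hf _), hQ, hn]
  rw [Finset.sum_const, Finset.card_univ, ← Nat.card_eq_fintype_card, ← Nat.cast_smul_eq_nsmul ℂ,
    smul_smul, div_eq_mul_inv]

theorem ncard_range_of_injective {α β : Type*} {f : α → β} (hf : Function.Injective f) :
    (Set.range f).ncard = Nat.card α := by
  rw [← Set.image_univ, Set.ncard_image_of_injective _ hf, Set.ncard_univ]

end ConstBiset

/-! ### Restriction to a subgroup followed by induction -/

section Tilde

variable {G : Type u} [Group G] [IsMulCommutative G]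

omit [IsMulCommutative G] in
theorem freeAt_tilde (X : Type u) [MulAction G X] (P : MonomialPair G) (u : TildeBiset G X) :
    FreeAt (TildeBiset G X) P u := by
  intro k hk h
  have h1 : u.1 * k = u.1 := congrArg Prod.fst h
  rw [mul_eq_left] at h1
  subst h1
  exact val_one P

theorem smul_quotient_eq (a : G) {K : Subgroup G} (x : G ⧸ K) : a • x = (a : G ⧸ K) * x := by
  induction x using QuotientGroup.induction_on
  rfl

theorem smul_quotient_eq_self {a : G} {K : Subgroup G} {x : G ⧸ K} : a • x = x ↔ a ∈ K := by
  rw [smul_quotient_eq, mul_eq_right, QuotientGroup.eq_one_iff]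

theorem tilde_smul_eq_iff {X : Type u} [MulAction G X] {u : TildeBiset G X} {a k : G} :
    a • u = MulOpposite.op k • u ↔ a = k ∧ a • u.2 = u.2 := by
  have : a • u = MulOpposite.op k • u ↔ a * u.1 = u.1 * k ∧ a • u.2 = u.2 := Prod.ext_iff
  rw [this, mul_comm' a, mul_right_inj]

variable [Finite G]

instance (X : Type u) [Finite X] : Finite (TildeBiset G X) :=
  inferInstanceAs (Finite (G × X))

omit [Group G] [IsMulCommutative G] [Finite G] in
theorem card_tildeBiset (X : Type u) : Nat.card (TildeBiset G X) = Nat.card G * Nat.card X :=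
  Nat.card_prod G X

/-- The subgroup of P fixes every point of G/K, so each double orbit is a free left G-orbit, and
there are |G : K| of them. -/
theorem bisetAct_tilde_of_le {K : Subgroup G} {P : MonomialPair G} (h : P.sub ≤ K) :
    bisetAct G (TildeBiset G (G ⧸ K)) (basisElt P) = (Nat.card (G ⧸ K) : ℂ) • basisElt P := by
  rw [bisetAct_basisElt, bisetPairAct_of_const (Q := P) (n := Nat.card G)
    (fun u => freeAt_tilde _ P u)]
  · rw [card_tildeBiset, Nat.cast_mul, mul_div_cancel_left₀ _ (cast_card_ne_zero G)]
  · refine fun u => bisetPair_eq _ (fun a ha => ⟨a, ha, ?_⟩) fun a k hk hu => ?_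
    · exact tilde_smul_eq_iff.2 ⟨rfl, smul_quotient_eq_self.2 (h ha)⟩
    · rw [(tilde_smul_eq_iff.1 hu).1]
      exact ⟨hk, rfl⟩
  · intro u
    rw [← ncard_range_of_injective (α := G)
      (f := fun a => (a • u : TildeBiset G (G ⧸ K)))]
    · congr 1
      ext v
      constructor
      · rintro ⟨a, k, hk, rfl⟩
        refine ⟨a * k, ?_⟩
        change (a * k) • u = _
        rw [mul_smul, tilde_smul_eq_iff.2 ⟨rfl, smul_quotient_eq_self.2 (h hk)⟩]
      · rintro ⟨a, rfl⟩
        exact ⟨a, 1, P.sub.one_mem, by simp⟩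
    · intro a b hab
      exact mul_right_cancel (congrArg Prod.fst hab : a * u.1 = b * u.1)

/-- For a pair over the whole group the biset is a single double orbit, and stabilizing the point of
G/K cuts the pair down to K. -/
theorem bisetAct_tilde_resPair_top (K : Subgroup G) (ψ : G →* ℂˣ) :
    bisetAct G (TildeBiset G (G ⧸ K)) (basisElt (resPair ψ ⊤)) = basisElt (resPair ψ K) := by
  rw [bisetAct_basisElt, bisetPairAct_of_const (Q := resPair ψ K)
    (n := Nat.card (TildeBiset G (G ⧸ K))) (fun u => freeAt_tilde _ _ u)]
  · rw [div_self, one_smul]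
    rw [card_tildeBiset, Nat.cast_mul]
    exact mul_ne_zero (cast_card_ne_zero _) (cast_card_ne_zero _)
  · refine fun u => bisetPair_eq _ (fun a ha => ⟨a, Subgroup.mem_top a, ?_⟩) fun a k hk hu => ?_
    · exact tilde_smul_eq_iff.2 ⟨rfl, smul_quotient_eq_self.2 ha⟩
    · obtain ⟨h1, h2⟩ := tilde_smul_eq_iff.1 hu
      have ha : a ∈ K := smul_quotient_eq_self.1 h2
      refine ⟨ha, ?_⟩
      rw [val_resPair_of_mem _ ha, val_resPair_of_mem _ (Subgroup.mem_top k), h1]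
  · intro u
    rw [← Set.ncard_univ]
    congr 1
    refine Set.eq_univ_of_forall fun v => ?_
    obtain ⟨a, ha⟩ := MulAction.exists_smul_eq G u.2 v.2
    refine ⟨a, (a * u.1)⁻¹ * v.1, Subgroup.mem_top _, Prod.ext ?_ ha.symm⟩
    change v.1 = a * (u.1 * ((a * u.1)⁻¹ * v.1))
    group

/-! ### The idempotent `ẽ_G^G` -/

-- Below M the interval above K always contains both M and ⊤, whose values -1 and 1 cancel; all
-- other values vanish by induction.
omit [IsMulCommutative G] in
open Classical in
theorem subgroupMoebius_eq {M : Subgroup G} (hM : ∀ K : Subgroup G, K ≤ M ↔ K ≠ ⊤)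
    (K : Subgroup G) : subgroupMoebius K = if K = ⊤ then 1 else if K = M then -1 else 0 := by
  let _ : Fintype (Subgroup G) := Fintype.ofFinite _
  let _ : LocallyFiniteOrder (Subgroup G) := Fintype.toLocallyFiniteOrder
  change IncidenceAlgebra.mu ℂ K ⊤ = _
  have hMtop : M ≠ ⊤ := (hM M).1 le_rfl
  have hI : Finset.Ioc M ⊤ = {⊤} := by
    ext L
    rw [Finset.mem_Ioc, Finset.mem_singleton]
    refine ⟨fun h => ?_, fun h => ⟨h ▸ hMtop.lt_top, le_top⟩⟩
    by_contra hL
    exact h.1.not_ge ((hM L).2 hL)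
  have hmuM : IncidenceAlgebra.mu ℂ M ⊤ = -1 := by
    rw [IncidenceAlgebra.mu_eq_neg_sum_Ioc_of_ne hMtop, hI, Finset.sum_singleton,
      IncidenceAlgebra.mu_self]
  induction K using WellFoundedGT.induction with
  | ind K ih =>
  split_ifs with h1 h2
  · rw [h1, IncidenceAlgebra.mu_self]
  · rw [h2, hmuM]
  · have hKM : K < M := lt_of_le_of_ne ((hM K).2 h1) h2
    rw [IncidenceAlgebra.mu_eq_neg_sum_Ioc_of_ne h1, neg_eq_zero]
    rw [← Finset.sum_subset (s₁ := {M, ⊤})]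
    · rw [Finset.sum_pair hMtop, hmuM, IncidenceAlgebra.mu_self]
      norm_num
    · intro L hL
      rw [Finset.mem_insert, Finset.mem_singleton] at hL
      rw [Finset.mem_Ioc]
      rcases hL with rfl | rfl
      · exact ⟨hKM, le_top⟩
      · exact ⟨hKM.trans_le le_top, le_top⟩
    · intro L hL hL'
      rw [Finset.mem_insert, Finset.mem_singleton, not_or] at hL'
      rw [ih L (Finset.mem_Ioc.1 hL).1, if_neg hL'.2, if_neg hL'.1]

omit [IsMulCommutative G] in
theorem eTilde_eq {M : Subgroup G} (hM : ∀ K : Subgroup G, K ≤ M ↔ K ≠ ⊤) :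
    eTilde G = bisetAct G (TildeBiset G (G ⧸ (⊤ : Subgroup G))) -
      (Nat.card M / Nat.card G : ℂ) • bisetAct G (TildeBiset G (G ⧸ M)) := by
  classical
  have := Fintype.ofFinite (Subgroup G)
  have hMtop : M ≠ ⊤ := (hM M).1 le_rfl
  have h1 := cast_card_ne_zero G
  rw [eTilde, finsum_eq_sum_of_fintype, ← Finset.sum_subset (Finset.subset_univ {⊤, M})]
  · rw [Finset.sum_pair hMtop.symm, subgroupMoebius_eq hM, subgroupMoebius_eq hM, if_pos rfl,
      if_neg hMtop, if_pos rfl, Subgroup.card_top, smul_add, smul_smul, smul_smul, mul_one,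
      inv_mul_cancel₀ h1, one_smul, mul_neg_one, mul_neg, inv_mul_eq_div]
    refine LinearMap.ext fun x => ?_
    rw [LinearMap.add_apply, LinearMap.sub_apply, LinearMap.smul_apply, LinearMap.smul_apply,
      neg_smul, sub_eq_add_neg]
  · intro K _ hK
    rw [Finset.mem_insert, Finset.mem_singleton, not_or] at hK
    rw [subgroupMoebius_eq hM, if_neg hK.1, if_neg hK.2, mul_zero, zero_smul]

theorem eTilde_resPair_top {M : Subgroup G} (hM : ∀ K : Subgroup G, K ≤ M ↔ K ≠ ⊤)
    (ψ : G →* ℂˣ) : eTilde G (basisElt (resPair ψ ⊤)) = topTerm M ψ := by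
  rw [eTilde_eq hM, LinearMap.sub_apply, LinearMap.smul_apply, bisetAct_tilde_resPair_top,
    bisetAct_tilde_resPair_top, topTerm]

/-- The subgroup lies in M, so restricting to M and inducing back multiplies by |G : M|, and the two
terms of ẽ cancel. -/
theorem eTilde_of_ne_top {M : Subgroup G} (hM : ∀ K : Subgroup G, K ≤ M ↔ K ≠ ⊤)
    {P : MonomialPair G} (hP : P.sub ≠ ⊤) : eTilde G (basisElt P) = 0 := by
  rw [eTilde_eq hM, LinearMap.sub_apply, LinearMap.smul_apply, bisetAct_tilde_of_le le_top,
    bisetAct_tilde_of_le ((hM _).2 hP), smul_smul, ← sub_smul]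
  have h1 : (Nat.card (G ⧸ (⊤ : Subgroup G)) : ℂ) = 1 := by
    rw [Nat.cast_eq_one]
    exact Subgroup.index_top
  rw [h1, M.card_eq_card_quotient_mul_card_subgroup, Nat.cast_mul]
  have h2 := cast_card_ne_zero M
  have h3 := cast_card_ne_zero (G ⧸ M)
  rw [show (1 - (Nat.card M : ℂ) / (Nat.card (G ⧸ M) * Nat.card M) * Nat.card (G ⧸ M)) = 0 by
    field_simp; ring, zero_smul]

open Classical in
theorem species_eTilde {M : Subgroup G} (hM : ∀ K : Subgroup G, K ≤ M ↔ K ≠ ⊤)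
    (x : MonBurnside G) {K : Subgroup G} {k : G} (hk : k ∈ K) :
    species K k (eTilde G x) = if K = ⊤ then species ⊤ k x else 0 := by
  have : (species K k).comp (eTilde G) = if K = ⊤ then species ⊤ k else 0 := by
    refine linearMap_ext_basisElt fun P => ?_
    rw [LinearMap.comp_apply]
    by_cases hP : P.sub = ⊤
    · obtain ⟨ψ, rfl⟩ := exists_eq_resPair_top hP
      rw [eTilde_resPair_top hM, species_topTerm hM ψ hk]
      split_ifs
      · rw [species_top_resPair_top]
      · rfl
    · rw [eTilde_of_ne_top hM hP, map_zero]
      split_ifs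
      · rw [species_basisElt, speciesPair_eq, if_neg]
        rwa [top_le_iff]
      · rfl
  rw [← LinearMap.comp_apply, this]
  split_ifs <;> rfl

-- An element outside M generates G, so its species at G is a value of the linearization.
omit [IsMulCommutative G] [Finite G] in
theorem species_top_eq_zero_of_mem_kerLin {M : Subgroup G}
    (hM : ∀ K : Subgroup G, K ≤ M ↔ K ≠ ⊤) {x : MonBurnside G} (hx : x ∈ kerLin G) {g : G}
    (hg : g ∉ M) : species ⊤ g x = 0 := by
  have hz : Subgroup.zpowers g = ⊤ := by
    by_contra h
    exact hg ((hM _).2 h (Subgroup.mem_zpowers g))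
  rw [← hz, ← lin_apply_eq_species, LinearMap.mem_ker.1 hx, Pi.zero_apply]

omit [IsMulCommutative G] [Finite G] in
theorem mem_kerLin_of_mem_topSpace {M : Subgroup G} (hM : ∀ K : Subgroup G, K ≤ M ↔ K ≠ ⊤)
    {x : MonBurnside G} (hx : x ∈ topSpace G) (hx' : ∀ g ∉ M, species ⊤ g x = 0) :
    x ∈ kerLin G := by
  refine LinearMap.mem_ker.2 (funext fun g => ?_)
  rw [lin_apply_eq_species, Pi.zero_apply]
  by_cases hz : Subgroup.zpowers g = ⊤
  · rw [hz]
    refine hx' g fun hg => ?_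
    exact (hM M).1 le_rfl (top_le_iff.1 (hz ▸ (Subgroup.zpowers_le.2 hg)))
  · exact hx _ hz g (Subgroup.mem_zpowers g)

/-- The description of ẽ_G^G 𝕊_p(G) as the functions on G supported on M. Conversely, such an
element is fixed by ẽ and is its own preimage. -/
theorem mem_eTildeKerLin_iff {M : Subgroup G} (hM : ∀ K : Subgroup G, K ≤ M ↔ K ≠ ⊤)
    {x : MonBurnside G} :
    x ∈ eTildeKerLin G ↔ x ∈ topSpace G ∧ ∀ g ∉ M, species ⊤ g x = 0 := by
  classical
  constructor
  · rintro ⟨y, hy, rfl⟩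
    refine ⟨fun K hK k hk => by rw [species_eTilde hM y hk, if_neg hK], fun g hg => ?_⟩
    rw [species_eTilde hM y (Subgroup.mem_top g), if_pos rfl,
      species_top_eq_zero_of_mem_kerLin hM hy hg]
  · rintro ⟨h1, h2⟩
    refine ⟨x, mem_kerLin_of_mem_topSpace hM h1 h2, ext_species fun K k hk => ?_⟩
    rw [species_eTilde hM x hk]
    split_ifs with h
    · rw [h]
    · exact (h1 K h k hk).symm

end Tilde

/-! ### Restriction to a subgroup -/

section Restriction

variable {G : Type u} [Group G] [IsMulCommutative G]

omit [IsMulCommutative G] in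
theorem freeAt_self (P : MonomialPair G) (u : G) : FreeAt G P u := by
  intro k hk h
  have h1 : u * k = u := h
  rw [mul_eq_left] at h1
  subst h1
  exact val_one P

theorem subgroup_smul_self_eq_iff {M : Subgroup G} {u k : G} {a : M} :
    a • u = MulOpposite.op k • u ↔ (a : G) = k := by
  have : a • u = MulOpposite.op k • u ↔ (a : G) * u = u * k := Iff.rfl
  rw [this, mul_comm' (a : G), mul_right_inj]

/-- The restriction of a pair to a subgroup. -/
def MonomialPair.restrict (P : MonomialPair G) (M : Subgroup G) : MonomialPair M where
  sub := P.sub.comap M.subtype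
  char := P.char.comp (M.subtype.subgroupComap P.sub)

omit [IsMulCommutative G] in
theorem restrict_val (P : MonomialPair G) (M : Subgroup G) {m : M} (hm : (m : G) ∈ P.sub) :
    (P.restrict M).val m = P.val m := by
  rw [val_of_mem _ hm, val_of_mem (P.restrict M) (show m ∈ (P.restrict M).sub from hm)]
  rfl

variable [Finite G]

theorem bisetAct_restrict {M : Subgroup G} {P : MonomialPair G} {n : ℕ}
    (hn : ∀ u : G, (doubleOrbit M G P.sub u).ncard = n) :
    bisetAct M G (basisElt P) = (Nat.card G / n : ℂ) • basisElt (P.restrict M) := by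
  rw [bisetAct_basisElt, bisetPairAct_of_const (freeAt_self P) (fun u => ?_) hn]
  refine bisetPair_eq _ (fun a ha => ⟨a, ha, ?_⟩) fun a k hk hu => ?_
  · exact subgroup_smul_self_eq_iff.2 rfl
  · have h1 := subgroup_smul_self_eq_iff.1 hu
    have ha : (a : G) ∈ P.sub := h1 ▸ hk
    exact ⟨ha, by rw [restrict_val P M ha, h1]⟩

omit [Finite G] in
theorem ncard_doubleOrbit_of_le {M L : Subgroup G} (h : L ≤ M) (u : G) :
    (doubleOrbit M G L u).ncard = Nat.card M := by
  rw [← ncard_range_of_injective (α := M) (f := fun a => a • u)]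
  · congr 1
    ext v
    constructor
    · rintro ⟨a, k, hk, rfl⟩
      refine ⟨a * ⟨k, h hk⟩, ?_⟩
      change (a * ⟨k, h hk⟩) • u = _
      rw [mul_smul, subgroup_smul_self_eq_iff.2 (show ((⟨k, h hk⟩ : M) : G) = k from rfl)]
    · rintro ⟨a, rfl⟩
      exact ⟨a, 1, L.one_mem, by simp⟩
  · intro a b hab
    exact Subtype.ext (mul_right_cancel (hab : (a : G) * u = b * u))

omit [IsMulCommutative G] [Finite G] in
theorem ncard_doubleOrbit_top (M : Subgroup G) (u : G) :
    (doubleOrbit M G (⊤ : Subgroup G) u).ncard = Nat.card G := by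
  rw [← Set.ncard_univ]
  congr 1
  refine Set.eq_univ_of_forall fun v => ⟨1, u⁻¹ * v, Subgroup.mem_top _, ?_⟩
  rw [one_smul]
  change v = u * (u⁻¹ * v)
  group

open Classical in
/-- The species of subgroups of `M` factor through the restriction to `M`. -/
theorem species_restrict {M : Subgroup G} (hM : ∀ K : Subgroup G, K ≤ M ↔ K ≠ ⊤)
    (x : MonBurnside G) {K : Subgroup G} (hK : K ≤ M) (k : M) :
    species (K.subgroupOf M) k (bisetAct M G x) = species K k x := by
  have : (species (K.subgroupOf M) k).comp (bisetAct M G) = species K k := by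
    refine linearMap_ext_basisElt fun P => ?_
    have h1 := cast_card_ne_zero G
    have h2 := cast_card_ne_zero M
    have h3 := cast_card_ne_zero P.sub
    have hle : K.subgroupOf M ≤ (P.restrict M).sub ↔ K ≤ P.sub := by
      refine ⟨fun h x hx => h (show (⟨x, hK hx⟩ : M) ∈ K.subgroupOf M from hx), fun h x hx => h hx⟩
    rw [LinearMap.comp_apply]
    -- Over ⊤ the biset is one double orbit; otherwise the pair lives in M and there are |G : M|
    -- double orbits, which accounts for the change of index.
    by_cases hP : P.sub = ⊤
    · rw [bisetAct_restrict (n := Nat.card G) fun u => by rw [hP, ncard_doubleOrbit_top],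
        div_self h1, one_smul, species_basisElt, species_basisElt, speciesPair_eq, speciesPair_eq,
        if_pos (hle.2 (hP ▸ le_top)), if_pos (hP ▸ le_top),
        restrict_val P M (hP ▸ Subgroup.mem_top _)]
      have hc : Nat.card (P.restrict M).sub = Nat.card M := by
        have : (P.restrict M).sub = ⊤ :=
          eq_top_iff.2 fun m _ => show (m : G) ∈ P.sub from hP ▸ Subgroup.mem_top _
        rw [this, Subgroup.card_top]
      rw [hc, hP, Subgroup.card_top, div_self h1, div_self h2]
    · have hPM := (hM _).2 hP
      rw [bisetAct_restrict (n := Nat.card M) fun u => ncard_doubleOrbit_of_le hPM u,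
        map_smul, species_basisElt, species_basisElt, speciesPair_eq, speciesPair_eq]
      have hc : Nat.card (P.restrict M).sub = Nat.card P.sub :=
        Nat.card_congr (Subgroup.subgroupOfEquivOfLe hPM).toEquiv
      simp only [hle, hc, smul_eq_mul]
      split_ifs with h
      · have hval : (P.restrict M).val k = P.val k := by
          by_cases hk : (k : G) ∈ P.sub
          · exact restrict_val P M hk
          · rw [val_of_notMem _ hk, val_of_notMem]
            exact hk
        rw [hval]
        field_simp
      · simp
  exact LinearMap.congr_fun this x

theorem mem_topSpace_of_restrict_eq_zero {M : Subgroup G}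
    (hM : ∀ K : Subgroup G, K ≤ M ↔ K ≠ ⊤) {x : MonBurnside G} (hx : bisetAct M G x = 0) :
    x ∈ topSpace G := by
  intro K hK k hk
  have hKM := (hM K).2 hK
  rw [← species_restrict hM x hKM ⟨k, hKM hk⟩, hx, map_zero]

end Restriction

/-! ### Bisets to smaller groups -/

section Small

variable {G : Type u} [Group G] [Finite G]

/-- Orbit-stabilizer for H × M and H × G: by `hS` both have the same stabilizer at u, so orbit
lengths are proportional to |M| and |G|. -/
theorem card_doubleOrbit_mul_card {H : Type u} [Group H] [Finite H] {U : Type u} [MulAction H U]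
    [MulAction Gᵐᵒᵖ U] [SMulCommClass H Gᵐᵒᵖ U] {M : Subgroup G} {u : U}
    (hS : ∀ (h : H) (k : G), h • u = MulOpposite.op k • u → k ∈ M) :
    Nat.card G * (doubleOrbit H U M u).ncard =
      Nat.card M * (doubleOrbit H U (⊤ : Subgroup G) u).ncard := by
  let _ : MulAction (H × G) U :=
    { smul := fun a v => a.1 • MulOpposite.op a.2⁻¹ • v
      one_smul := fun v => by
        change (1 : H) • MulOpposite.op (1 : G)⁻¹ • v = v
        simp
      mul_smul := fun a b v => by
        change (a.1 * b.1) • MulOpposite.op (a.2 * b.2)⁻¹ • v =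
          a.1 • MulOpposite.op a.2⁻¹ • b.1 • MulOpposite.op b.2⁻¹ • v
        rw [mul_inv_rev, MulOpposite.op_mul, mul_smul, mul_smul, smul_comm b.1] }
  have hsm : ∀ (a : H × G) (v : U), a • v = a.1 • MulOpposite.op a.2⁻¹ • v := fun _ _ => rfl
  have horb : ∀ K : Subgroup G,
      doubleOrbit H U K u = MulAction.orbit ((⊤ : Subgroup H).prod K) u := by
    intro K
    ext v
    constructor
    · rintro ⟨h, k, hk, rfl⟩
      exact ⟨⟨(h, k⁻¹), ⟨Subgroup.mem_top _, K.inv_mem hk⟩⟩, by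
        change (h, k⁻¹) • u = _
        rw [hsm, inv_inv]⟩
    · rintro ⟨⟨⟨h, k⟩, hk⟩, rfl⟩
      exact ⟨h, k⁻¹, K.inv_mem hk.2, rfl⟩
  have hcard : ∀ K : Subgroup G, (∀ (h : H) (k : G), h • u = MulOpposite.op k • u → k ∈ K) →
      (doubleOrbit H U K u).ncard * Nat.card (MulAction.stabilizer (H × G) u) =
        Nat.card H * Nat.card K := by
    intro K hK
    have h1 : MulAction.stabilizer (H × G) u ≤ (⊤ : Subgroup H).prod K := by
      rintro ⟨h, k⟩ ha
      refine ⟨Subgroup.mem_top _, hK h k ?_⟩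
      have ha' : h • MulOpposite.op k⁻¹ • u = u := ha
      rw [MulOpposite.op_inv, smul_comm, inv_smul_eq_iff] at ha'
      exact ha'
    have h2 : MulAction.stabilizer ((⊤ : Subgroup H).prod K) u =
        (MulAction.stabilizer (H × G) u).subgroupOf _ := rfl
    rw [horb, ← Nat.card_coe_set_eq, ← Nat.card_congr (Subgroup.subgroupOfEquivOfLe h1).toEquiv,
      ← h2, ← Nat.card_prod,
      ← Nat.card_congr (MulAction.orbitProdStabilizerEquivGroup ((⊤ : Subgroup H).prod K) u).symm,
      Nat.card_congr (Subgroup.prodEquiv _ _).toEquiv, Nat.card_prod, Subgroup.card_top]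
  have h1 := hcard M hS
  have h2 := hcard ⊤ fun _ _ _ => Subgroup.mem_top _
  rw [Subgroup.card_top] at h2
  refine Nat.eq_of_mul_eq_mul_right (Nat.card_pos (α := MulAction.stabilizer (H × G) u)) ?_
  rw [mul_assoc, h1, mul_assoc, h2]
  ring

-- At each u compare the terms of [G,ψ] and [M,ψ|_M]. If u has nontrivial right stabilizer, that
-- stabilizer contains w and neither orbit is free. Otherwise the elements k with hu = uk for some h
-- form a proper subgroup because |H| < |G|; it lies in M, so the stabilizing pairs agree and the
-- orbit lengths compensate the coefficient |M|/|G|.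
open Classical in
theorem bisetAct_topTerm_eq_zero {M : Subgroup G} (hM : ∀ K : Subgroup G, K ≤ M ↔ K ≠ ⊤) {w : G}
    (hw : ∀ K : Subgroup G, K ≠ ⊥ → w ∈ K) (hMbot : M ≠ ⊥) {ψ : G →* ℂˣ} (hψ : ψ w ≠ 1)
    {H : Type u} [Group H] [Finite H] (hH : Nat.card H < Nat.card G) (U : Type u) [Finite U]
    [MulAction H U] [MulAction Gᵐᵒᵖ U] [SMulCommClass H Gᵐᵒᵖ U] :
    bisetAct H U (topTerm M ψ) = 0 := by
  have := Fintype.ofFinite U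
  rw [topTerm, map_sub, map_smul, bisetAct_basisElt, bisetAct_basisElt, sub_eq_zero, bisetPairAct,
    bisetPairAct, finsum_eq_sum_of_fintype, finsum_eq_sum_of_fintype, Finset.smul_sum]
  refine Finset.sum_congr rfl fun u _ => ?_
  have hψ' : (ψ w : ℂ) ≠ 1 := fun h => hψ (Units.ext h)
  let S : Subgroup G := (MulAction.stabilizer Gᵐᵒᵖ u).unop
  have hS : ∀ g, g ∈ S ↔ MulOpposite.op g • u = u := fun _ => Iff.rfl
  by_cases hbot : S = ⊥
  · have hfree : ∀ K : Subgroup G, FreeAt U (resPair ψ K) u := by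
      intro K k hk hu
      obtain rfl : k = 1 := by rwa [← hS, hbot, Subgroup.mem_bot] at hu
      exact val_one _
    rw [dif_pos (hfree ⊤), dif_pos (hfree M)]
    have hinj : ∀ k l : G, MulOpposite.op k • u = MulOpposite.op l • u → k = l := by
      intro k l h
      have : k * l⁻¹ ∈ S := by
        rw [hS, MulOpposite.op_mul, mul_smul, h, ← mul_smul, ← MulOpposite.op_mul]
        simp
      rwa [hbot, Subgroup.mem_bot, mul_inv_eq_one] at this
    let T : Subgroup G :=
      { carrier := {k | ∃ h : H, h • u = MulOpposite.op k • u}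
        one_mem' := ⟨1, by simp⟩
        mul_mem' := by
          rintro k l ⟨a, ha⟩ ⟨b, hb⟩
          exact ⟨a * b, by rw [mul_smul, hb, smul_comm, ha, ← mul_smul, ← MulOpposite.op_mul]⟩
        inv_mem' := by
          rintro k ⟨a, ha⟩
          refine ⟨a⁻¹, ?_⟩
          rw [inv_smul_eq_iff, smul_comm, ha, ← mul_smul, ← MulOpposite.op_mul]
          simp }
    have hT : T ≤ M := by
      rw [hM]
      intro htop
      have hT' : ∀ k : G, ∃ h : H, h • u = MulOpposite.op k • u := fun k =>
        (htop ▸ Subgroup.mem_top k : k ∈ T)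
      choose f hf using hT'
      -- If every k were matched by some h, freeness of u would embed G into H.
      refine hH.not_ge (Nat.card_le_card_of_injective f fun k l h => hinj k l ?_)
      rw [← hf, ← hf, h]
    have hkM : ∀ (h : H) (k : G), h • u = MulOpposite.op k • u → k ∈ M := fun h k hu => hT ⟨h, hu⟩
    have hpair : bisetPair (H := H) (resPair ψ ⊤) u (hfree ⊤) =
        bisetPair (resPair ψ M) u (hfree M) := by
      refine bisetPair_eq _ ?_ ?_
      · rintro h ⟨k, _, hu⟩
        exact ⟨k, Subgroup.mem_top k, hu⟩
      · intro h k _ hu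
        refine ⟨⟨k, hkM h k hu, hu⟩, ?_⟩
        rw [bisetPair_val _ _ _ (hkM h k hu) hu, val_resPair_of_mem _ (hkM h k hu),
          val_resPair_of_mem _ (Subgroup.mem_top k)]
    rw [hpair, smul_smul]
    congr 1
    have hcard := congrArg (Nat.cast (R := ℂ)) (card_doubleOrbit_mul_card hkM)
    push_cast at hcard
    have hne : ∀ K : Subgroup G, ((doubleOrbit H U K u).ncard : ℂ) ≠ 0 := by
      intro K
      exact Nat.cast_ne_zero.2
        (Set.ncard_ne_zero_of_mem (a := u) ⟨1, 1, K.one_mem, by simp⟩ (Set.toFinite _))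
    have h1 := hne ⊤
    have h2 := hne M
    have h3 := cast_card_ne_zero G
    change ((doubleOrbit H U (⊤ : Subgroup G) u).ncard : ℂ)⁻¹ =
      (Nat.card M / Nat.card G : ℂ) * ((doubleOrbit H U M u).ncard : ℂ)⁻¹
    field_simp
    linear_combination hcard
  · have hnot : ∀ K : Subgroup G, K ≠ ⊥ → ¬ FreeAt U (resPair ψ K) u := by
      intro K hK hf
      have h1 := hf w (hw K hK) ((hS w).1 (hw S hbot))
      rw [val_resPair_of_mem _ (hw K hK)] at h1
      exact hψ' h1
    have htop : (⊤ : Subgroup G) ≠ ⊥ := fun h => hMbot (eq_bot_iff.2 (h ▸ le_top))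
    rw [dif_neg (hnot ⊤ htop), dif_neg (hnot M hMbot), smul_zero]

end Small

/-! ### Deflation -/

section Deflation

variable {G : Type u} [Group G] [IsMulCommutative G] [Finite G] {Z : Subgroup G} [Z.Normal]

instance : IsMulCommutative (G ⧸ Z) where
  is_comm :=
    { comm := fun a b => by
        induction a using QuotientGroup.induction_on
        induction b using QuotientGroup.induction_on
        rw [← QuotientGroup.mk_mul, mul_comm', QuotientGroup.mk_mul] }

instance : Finite (DefBiset Z) := inferInstanceAs (Finite (G ⧸ Z))

omit [Finite G] in
theorem defBiset_smul_eq_iff {u : DefBiset Z} {a k : G} :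
    (a : G ⧸ Z) • u = MulOpposite.op k • u ↔ (a : G ⧸ Z) = k := by
  obtain ⟨g, rfl⟩ := QuotientGroup.mk_surjective (s := Z) u
  change (a : G ⧸ Z) * (g : G ⧸ Z) = (g : G ⧸ Z) * (k : G ⧸ Z) ↔ _
  rw [← QuotientGroup.mk_mul, ← QuotientGroup.mk_mul, mul_comm' a, QuotientGroup.mk_mul,
    QuotientGroup.mk_mul, mul_right_inj]

omit [Finite G] in
theorem freeAt_defBiset_iff {P : MonomialPair G} {u : DefBiset Z} :
    FreeAt (DefBiset Z) P u ↔ ∀ k ∈ P.sub, k ∈ Z → P.val k = 1 := by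
  refine forall₂_congr fun k _ => imp_congr_left ?_
  have := defBiset_smul_eq_iff (u := u) (a := 1) (k := k)
  rw [QuotientGroup.mk_one, one_smul] at this
  rw [eq_comm, this, eq_comm, QuotientGroup.eq_one_iff]

-- The image of M in G/Z is proper as Z ≤ M, so only [G,ψ] is seen by the species at the whole
-- quotient; it survives exactly when ψ factors through G/Z.
open Classical in
theorem species_top_deflation_topTerm {M : Subgroup G} (hM : ∀ K : Subgroup G, K ≤ M ↔ K ≠ ⊤)
    (hZ : Z ≤ M) (ψ : G →* ℂˣ) (g : G) :
    species (⊤ : Subgroup (G ⧸ Z)) (g : G ⧸ Z) (deflation Z (topTerm M ψ)) =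
      if ∀ z ∈ Z, ψ z = 1 then (ψ g : ℂ) else 0 := by
  have hMzero : species (⊤ : Subgroup (G ⧸ Z)) (g : G ⧸ Z)
      (bisetAct (G ⧸ Z) (DefBiset Z) (basisElt (resPair ψ M))) = 0 := by
    have := Fintype.ofFinite (DefBiset Z)
    rw [bisetAct_basisElt, bisetPairAct, finsum_eq_sum_of_fintype, map_sum]
    refine Finset.sum_eq_zero fun u _ => ?_
    split_ifs with hf
    · rw [map_smul, species_basisElt, speciesPair_eq, if_neg, smul_zero]
      intro htop
      refine (hM M).1 le_rfl (eq_top_iff.2 fun a _ => ?_)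
      obtain ⟨k, hk, hu⟩ := htop (Subgroup.mem_top (a : G ⧸ Z))
      have h1 := QuotientGroup.eq.1 (defBiset_smul_eq_iff.1 hu)
      have h2 := M.mul_mem hk (M.inv_mem (hZ h1))
      simpa using h2
    · rw [map_zero]
  rw [deflation, topTerm, map_sub, map_smul, map_sub, map_smul, hMzero, smul_zero, sub_zero]
  split_ifs with hψ
  · let φ : G ⧸ Z →* ℂˣ := QuotientGroup.lift Z ψ hψ
    rw [bisetAct_basisElt, bisetPairAct_of_const (Q := resPair φ ⊤) (n := Nat.card (DefBiset Z))
      (fun u => freeAt_defBiset_iff.2 fun k hk hkZ => by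
        rw [val_resPair_of_mem ψ (Subgroup.mem_top k), hψ k hkZ, Units.val_one])]
    · rw [div_self, one_smul, species_top_resPair_top]
      · rfl
      · exact cast_card_ne_zero (G ⧸ Z)
    · refine fun u => bisetPair_eq _ (fun a _ => ?_) fun a k hk hu => ⟨Subgroup.mem_top a, ?_⟩
      · induction a using QuotientGroup.induction_on with
        | H a => exact ⟨a, Subgroup.mem_top a, defBiset_smul_eq_iff.2 rfl⟩
      · induction a using QuotientGroup.induction_on with
        | H a =>
        rw [defBiset_smul_eq_iff.1 hu, val_resPair_of_mem ψ (Subgroup.mem_top k),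
          val_resPair_of_mem φ (Subgroup.mem_top _)]
        rfl
    · intro u
      rw [← Set.ncard_univ]
      congr 1
      refine Set.eq_univ_of_forall fun v => ?_
      obtain ⟨a, ha⟩ : ∃ a : G ⧸ Z, a • u = v := by
        obtain ⟨x, rfl⟩ := QuotientGroup.mk_surjective (s := Z) u
        obtain ⟨y, rfl⟩ := QuotientGroup.mk_surjective (s := Z) v
        exact ⟨(y : G ⧸ Z) * (x : G ⧸ Z)⁻¹, inv_mul_cancel_right (y : G ⧸ Z) (x : G ⧸ Z)⟩
      exact ⟨a, 1, Subgroup.mem_top _, by rw [MulOpposite.op_one, one_smul]; exact ha.symm⟩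
  · rw [bisetAct_basisElt, bisetPairAct, finsum_eq_zero_of_forall_eq_zero, map_zero]
    intro u
    rw [dif_neg]
    rw [freeAt_defBiset_iff]
    intro h
    refine hψ fun z hz => Units.ext ?_
    rw [Units.val_one, ← h z (Subgroup.mem_top z) hz, val_resPair_of_mem ψ (Subgroup.mem_top z)]

/-- Summing over a coset of Z multiplies the characters trivial on Z by |Z| and kills the rest,
which up to this factor is what deflation does. -/
theorem sum_species_of_deflation_eq_zero [Fintype Z] {M : Subgroup G}
    (hM : ∀ K : Subgroup G, K ≤ M ↔ K ≠ ⊤) (hZ : Z ≤ M) {x : MonBurnside G} (hx : x ∈ topSpace G)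
    (hdef : deflation Z x = 0) (g : G) : ∑ z : Z, species (⊤ : Subgroup G) (g * z) x = 0 := by
  classical
  have := Fintype.ofFinite (G →* ℂˣ)
  obtain ⟨a, rfl⟩ := exists_eq_sum_topTerm hM hx
  have h1 : ∑ ψ, a ψ * (if ∀ z ∈ Z, ψ z = 1 then (ψ g : ℂ) else 0) = 0 := by
    have := congrArg (species (⊤ : Subgroup (G ⧸ Z)) (g : G ⧸ Z)) hdef
    simpa only [map_sum, map_smul, species_top_deflation_topTerm hM hZ, map_zero, smul_eq_mul]
      using this
  simp_rw [species_top_sum_topTerm hM]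
  rw [Finset.sum_comm, ← mul_zero (Nat.card Z : ℂ), ← h1, Finset.mul_sum]
  refine Finset.sum_congr rfl fun ψ _ => ?_
  simp_rw [map_mul, Units.val_mul, ← mul_assoc]
  rw [← Finset.mul_sum]
  split_ifs with hψ
  · rw [Fintype.sum_congr _ (fun _ => (1 : ℂ)) fun z => by rw [hψ z z.2, Units.val_one]]
    rw [Finset.sum_const, Finset.card_univ, ← Nat.card_eq_fintype_card, nsmul_one]
    ring
  · push Not at hψ
    obtain ⟨w, hw, hψw⟩ := hψ
    rw [sum_apply_subgroup_of_ne_one hw hψw]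
    simp

omit [Z.Normal] in
theorem bisetAct_eq_zero_of_sum_species [Fintype Z] {M : Subgroup G}
    (hM : ∀ K : Subgroup G, K ≤ M ↔ K ≠ ⊤) (hMbot : M ≠ ⊥)
    (hZ : ∀ K : Subgroup G, K ≠ ⊥ → Z ≤ K) {x : MonBurnside G} (hx : x ∈ topSpace G)
    (hsum : ∀ g, ∑ z : Z, species (⊤ : Subgroup G) (g * z) x = 0) {H : Type u} [Group H] [Finite H]
    (hH : Nat.card H < Nat.card G) (U : Type u) [Finite U] [MulAction H U] [MulAction Gᵐᵒᵖ U]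
    [SMulCommClass H Gᵐᵒᵖ U] : bisetAct H U x = 0 := by
  classical
  have := Fintype.ofFinite (G →* ℂˣ)
  obtain ⟨a, rfl⟩ := exists_eq_sum_topTerm hM hx
  rw [map_sum]
  refine Finset.sum_eq_zero fun ψ _ => ?_
  rw [map_smul]
  by_cases hψ : ∀ z ∈ Z, ψ z = 1
  -- These products are the coefficients of the coset sum as a function of g, so independence of
  -- characters kills them all; for ψ trivial on Z the second factor is |Z|.
  · suffices h : a ψ * ∑ z : Z, (ψ z : ℂ) = 0 by
      rw [Fintype.sum_congr _ (fun _ => (1 : ℂ)) fun z => by rw [hψ z z.2, Units.val_one],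
        Finset.sum_const, Finset.card_univ, ← Nat.card_eq_fintype_card, nsmul_one] at h
      rw [(mul_eq_zero.1 h).resolve_right (cast_card_ne_zero Z), zero_smul]
    refine eq_zero_of_sum_char_eq_zero (c := fun ψ => a ψ * ∑ z : Z, (ψ z : ℂ)) (fun g => ?_) ψ
    rw [← hsum g]
    simp_rw [species_top_sum_topTerm hM]
    rw [Finset.sum_comm]
    refine Finset.sum_congr rfl fun ψ _ => ?_
    simp_rw [map_mul, Units.val_mul, ← mul_assoc]
    rw [← Finset.mul_sum]
    ring
  · push Not at hψ
    obtain ⟨w, hw, hψw⟩ := hψ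
    rw [bisetAct_topTerm_eq_zero hM (fun K hK => hZ K hK hw) hMbot hψw hH, smul_zero]

end Deflation

/-! ### Automorphisms of finite cyclic groups -/

section CyclicAut

variable {G : Type*} [Group G] [Finite G] [IsCyclic G]

/-- A cyclic group has at most n solutions of xⁿ = 1, and for n the order of h the subgroup ⟨h⟩
already provides n. -/
theorem mem_zpowers_iff_orderOf_dvd {g h : G} :
    g ∈ Subgroup.zpowers h ↔ orderOf g ∣ orderOf h := by
  classical
  refine ⟨orderOf_dvd_of_mem_zpowers, fun hg => ?_⟩
  have := Fintype.ofFinite G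
  have hle := IsCyclic.card_pow_eq_one_le (α := G) (orderOf_pos h)
  have hsub : (Subgroup.zpowers h : Set G).toFinset ⊆
      Finset.univ.filter fun a : G => a ^ orderOf h = 1 := by
    intro x hx
    rw [Set.mem_toFinset, SetLike.mem_coe] at hx
    rw [Finset.mem_filter]
    exact ⟨Finset.mem_univ _, orderOf_dvd_iff_pow_eq_one.1 (orderOf_dvd_of_mem_zpowers hx)⟩
  have heq := Finset.eq_of_subset_of_card_le hsub (hle.trans (by
    rw [← Set.ncard_eq_toFinset_card', ← Nat.card_coe_set_eq]
    exact (Nat.card_zpowers h).ge))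
  have : g ∈ (Subgroup.zpowers h : Set G).toFinset := by
    rw [heq, Finset.mem_filter]
    exact ⟨Finset.mem_univ _, orderOf_dvd_iff_pow_eq_one.1 hg⟩
  simpa using this

/-- Makes the isomorphism Aut(G) ≅ (ℤ/n)ˣ explicit; commutativity, extension of automorphisms and
the criterion for primitivity all rest on it. -/
theorem mulAut_apply_eq_pow (β : MulAut G) (x : G) :
    β x = x ^ ((IsCyclic.mulAutMulEquiv G β : (ZMod (Nat.card G))ˣ) : ZMod (Nat.card G)).val := by
  have : NeZero (Nat.card G) := ⟨Nat.card_pos.ne'⟩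
  let e := zmodCyclicMulEquiv (G := G) inferInstance
  let g := e (Multiplicative.ofAdd 1)
  have hu : ((IsCyclic.mulAutMulEquiv G β : (ZMod (Nat.card G))ˣ) : ZMod (Nat.card G)) =
      (e.symm (β g)).toAdd := rfl
  have he : ∀ a : ZMod (Nat.card G), e (Multiplicative.ofAdd a) = g ^ a.val := by
    intro a
    rw [← map_pow, ← ofAdd_nsmul, nsmul_one, ZMod.natCast_zmod_val]
  obtain ⟨y, rfl⟩ := e.surjective x
  obtain ⟨a, rfl⟩ := Multiplicative.ofAdd.surjective y
  rw [he, map_pow, ← pow_mul, mul_comm, pow_mul]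
  congr 1
  rw [hu, ← he, ofAdd_toAdd, MulEquiv.apply_symm_apply]

instance : IsMulCommutative (MulAut G) where
  is_comm :=
    { comm := fun β γ => by
        ext x
        rw [MulAut.mul_apply, MulAut.mul_apply, mulAut_apply_eq_pow β x, map_pow,
          ← mulAut_apply_eq_pow] }

omit [Finite G] [IsCyclic G] in
theorem mulAut_ext_of_generator {h : G} {α γ : MulAut (Subgroup.zpowers h)}
    (H : (α ⟨h, Subgroup.mem_zpowers h⟩ : G) = γ ⟨h, Subgroup.mem_zpowers h⟩) : α = γ := by
  have : α.toMonoidHom = γ.toMonoidHom := by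
    rw [MonoidHom.eq_iff_eq_on_generator (g := (⟨h, Subgroup.mem_zpowers h⟩ : Subgroup.zpowers h))]
    · exact Subtype.ext H
    · rintro ⟨x, hx⟩
      obtain ⟨n, rfl⟩ := Subgroup.mem_zpowers_iff.1 hx
      exact ⟨n, Subtype.ext (by simp)⟩
  ext x
  exact congrArg Subtype.val (DFunLike.congr_fun this x)

/-- Both elements generate the same subgroup. So the elements of the order of h form one orbit of
Aut(⟨h⟩), the support of each `eChar h φ`. -/
theorem exists_mulAut_zpowers {h g : G} (hg : orderOf g = orderOf h) :
    ∃ α : MulAut (Subgroup.zpowers h), (α ⟨h, Subgroup.mem_zpowers h⟩ : G) = g := by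
  have hmem : g ∈ Subgroup.zpowers h := mem_zpowers_iff_orderOf_dvd.2 hg.dvd
  have hmem' : h ∈ Subgroup.zpowers g := mem_zpowers_iff_orderOf_dvd.2 hg.symm.dvd
  have h1 : ∀ x : Subgroup.zpowers h,
      x ∈ Subgroup.zpowers (⟨h, Subgroup.mem_zpowers h⟩ : Subgroup.zpowers h) := by
    rintro ⟨x, hx⟩
    obtain ⟨n, rfl⟩ := Subgroup.mem_zpowers_iff.1 hx
    exact ⟨n, Subtype.ext (by simp)⟩
  have h2 : ∀ x : Subgroup.zpowers h,
      x ∈ Subgroup.zpowers (⟨g, hmem⟩ : Subgroup.zpowers h) := by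
    rintro ⟨x, hx⟩
    obtain ⟨n, rfl⟩ := Subgroup.mem_zpowers_iff.1 (Subgroup.zpowers_le.2 hmem' hx)
    exact ⟨n, Subtype.ext (by simp)⟩
  refine ⟨mulEquivOfOrderOfEq h1 h2 (by rw [Subgroup.orderOf_mk, Subgroup.orderOf_mk, hg]), ?_⟩
  rw [mulEquivOfOrderOfEq_apply_gen]

omit [Finite G] [IsCyclic G] in
theorem orderOf_mulAut_apply {h : G} (α : MulAut (Subgroup.zpowers h)) :
    orderOf (α ⟨h, Subgroup.mem_zpowers h⟩ : G) = orderOf h := by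
  rw [Subgroup.orderOf_coe, MulEquiv.orderOf_eq, Subgroup.orderOf_mk]

/-- Automorphisms of subgroups of a finite cyclic group extend to the whole group. -/
theorem characteristic_surjective (H : Subgroup G) [H.Characteristic] :
    Function.Surjective (MulAut.characteristic H) := by
  intro α
  have : NeZero (Nat.card G) := ⟨Nat.card_pos.ne'⟩
  have : NeZero (Nat.card H) := ⟨Nat.card_pos.ne'⟩
  have hd : Nat.card H ∣ Nat.card G := H.card_subgroup_dvd_card
  -- Extending α means lifting its exponent from a unit modulo |H| to a unit modulo |G|.
  obtain ⟨v, hv⟩ := ZMod.unitsMap_surjective hd (IsCyclic.mulAutMulEquiv H α)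
  refine ⟨(IsCyclic.mulAutMulEquiv G).symm v, ?_⟩
  ext x
  rw [MulAut.characteristic_apply_apply_coe, mulAut_apply_eq_pow, MulEquiv.apply_symm_apply,
    mulAut_apply_eq_pow α, ← hv, ZMod.unitsMap_def, Units.coe_map, Subgroup.coe_pow]
  refine pow_eq_pow_iff_modEq.2 (Nat.ModEq.of_dvd (n := Nat.card H) ?_ ?_)
  · rw [Subgroup.orderOf_coe]
    exact orderOf_dvd_natCard x
  · rw [← ZMod.natCast_eq_natCast_iff, ZMod.natCast_zmod_val]
    exact ZMod.natCast_val _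

omit [Finite G] in
theorem characteristic_eq_one_iff {h : G} {β : MulAut G} :
    MulAut.characteristic (Subgroup.zpowers h) β = 1 ↔ β h = h := by
  constructor
  · intro H
    have := congrArg (fun α : MulAut (Subgroup.zpowers h) =>
      (α ⟨h, Subgroup.mem_zpowers h⟩ : G)) H
    exact this
  · intro H
    exact mulAut_ext_of_generator H

end CyclicAut

/-! ### The elements `e_{G,l,φ}` -/

section EChar

variable {G : Type u} [Group G] [Finite G] [IsCyclic G]

omit [Finite G] [IsCyclic G] in
theorem eChar_eq_sum (h : G) [Fintype (MulAut (Subgroup.zpowers h))]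
    (φ : MulAut (Subgroup.zpowers h) →* ℂˣ) : eChar h φ =
      ∑ α, (φ α⁻¹ : ℂ) • primIdem (⊤ : Subgroup G) (α ⟨h, Subgroup.mem_zpowers h⟩ : G) := by
  rw [eChar, finsum_eq_sum_of_fintype]

variable {M : Subgroup G} (hM : ∀ K : Subgroup G, K ≤ M ↔ K ≠ ⊤)

include hM

theorem eChar_mem_topSpace (h : G) (φ : MulAut (Subgroup.zpowers h) →* ℂˣ) :
    eChar h φ ∈ topSpace G := by
  have := Fintype.ofFinite (MulAut (Subgroup.zpowers h))
  rw [eChar_eq_sum]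
  exact Submodule.sum_mem _ fun α _ => Submodule.smul_mem _ _ (primIdem_mem_topSpace hM _)

theorem species_top_eChar_of_apply_eq {h g : G} (φ : MulAut (Subgroup.zpowers h) →* ℂˣ)
    {α : MulAut (Subgroup.zpowers h)} (hα : (α ⟨h, Subgroup.mem_zpowers h⟩ : G) = g) :
    species ⊤ g (eChar h φ) = (φ α⁻¹ : ℂ) := by
  classical
  have := Fintype.ofFinite (MulAut (Subgroup.zpowers h))
  rw [eChar_eq_sum, map_sum, Finset.sum_eq_single α]
  · rw [map_smul, species_top_primIdem hM, if_pos hα, smul_eq_mul, mul_one]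
  · intro γ _ hγ
    rw [map_smul, species_top_primIdem hM, if_neg, smul_zero]
    exact fun h0 => hγ (mulAut_ext_of_generator (h0.trans hα.symm))
  · exact fun h0 => absurd (Finset.mem_univ _) h0

theorem species_top_eChar_of_orderOf_ne {h g : G} (φ : MulAut (Subgroup.zpowers h) →* ℂˣ)
    (hg : orderOf g ≠ orderOf h) : species ⊤ g (eChar h φ) = 0 := by
  classical
  have := Fintype.ofFinite (MulAut (Subgroup.zpowers h))
  rw [eChar_eq_sum, map_sum]
  refine Finset.sum_eq_zero fun α _ => ?_
  rw [map_smul, species_top_primIdem hM, if_neg, smul_zero]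
  exact fun h0 => hg (by rw [← h0, orderOf_mulAut_apply])

theorem eChar_mem_eTildeKerLin {h : G} (hh : h ∈ M) (φ : MulAut (Subgroup.zpowers h) →* ℂˣ) :
    eChar h φ ∈ eTildeKerLin G := by
  rw [mem_eTildeKerLin_iff hM]
  refine ⟨eChar_mem_topSpace hM h φ, fun g hg => species_top_eChar_of_orderOf_ne hM φ fun h0 => ?_⟩
  exact hg (Subgroup.zpowers_le.2 hh (mem_zpowers_iff_orderOf_dvd.2 h0.dvd))

-- Fourier inversion on the finite abelian group Aut(⟨h⟩).
omit hM in
theorem primIdem_mem_span_eChar {h g : G} (hg : orderOf g = orderOf h) :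
    primIdem (⊤ : Subgroup G) g ∈ Submodule.span ℂ (Set.range (eChar h)) := by
  classical
  have := Fintype.ofFinite (MulAut (Subgroup.zpowers h))
  have := Fintype.ofFinite (MulAut (Subgroup.zpowers h) →* ℂˣ)
  obtain ⟨α, hα⟩ := exists_mulAut_zpowers hg
  have key : primIdem (⊤ : Subgroup G) g = (Nat.card (MulAut (Subgroup.zpowers h)) : ℂ)⁻¹ •
      ∑ φ : MulAut (Subgroup.zpowers h) →* ℂˣ, (φ α : ℂ) • eChar h φ := by
    simp_rw [eChar_eq_sum, Finset.smul_sum, smul_smul]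
    rw [Finset.sum_comm, Finset.sum_eq_single α]
    · rw [← Finset.sum_smul, hα, ← Finset.mul_sum]
      rw [sum_char_mul_inv, if_pos rfl, inv_mul_cancel₀ (cast_card_ne_zero _), one_smul]
    · intro γ _ hγ
      rw [← Finset.sum_smul, ← Finset.mul_sum]
      rw [sum_char_mul_inv, if_neg hγ, mul_zero, zero_smul]
    · exact fun h0 => absurd (Finset.mem_univ _) h0
  rw [key]
  exact Submodule.smul_mem _ _ (Submodule.sum_mem _ fun φ _ =>
    Submodule.smul_mem _ _ (Submodule.subset_span ⟨φ, rfl⟩))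

omit hM in
theorem species_autRep (β : MulAut G) (K : Subgroup G) (k : G) (x : MonBurnside G) :
    species K k (autRep G β x) = species (K.map β.symm.toMonoidHom) (β.symm k) x := by
  classical
  have : (species K k).comp (autRep G β) = species (K.map β.symm.toMonoidHom) (β.symm k) := by
    refine linearMap_ext_basisElt fun P => ?_
    rw [LinearMap.comp_apply, autRep_basisElt, species_basisElt, species_basisElt, speciesPair_eq,
      speciesPair_eq, card_map_sub, val_map]
    refine if_congr ?_ rfl rfl
    rw [Subgroup.map_le_iff_le_comap]
    exact forall₂_congr fun y _ => mem_map_sub β P y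
  exact LinearMap.congr_fun this x

theorem autRep_primIdem (β : MulAut G) (g : G) :
    autRep G β (primIdem ⊤ g) = primIdem ⊤ (β g) := by
  refine IsPrimIdem.unique (fun K k hk => ?_) (primIdem_spec hM (β g))
  rw [species_autRep]
  refine (primIdem_spec hM g _ _ (Subgroup.mem_map_of_mem β.symm.toMonoidHom hk)).trans ?_
  congr 1
  rw [pairConj_top_iff, pairConj_top_iff, eq_iff_iff]
  change K.map β.symm.toMonoidHom = ⊤ ∧ g = β.symm k ↔ _
  have htop : (⊤ : Subgroup G).map β.symm.toMonoidHom = ⊤ := Subgroup.map_equiv_top β.symm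
  refine and_congr ⟨fun H => ?_, fun H => by rw [H, htop]⟩ (MulEquiv.eq_symm_apply β)
  exact Subgroup.map_injective β.symm.injective (H.trans htop.symm)

theorem autRep_eChar (h : G) (φ : MulAut (Subgroup.zpowers h) →* ℂˣ) (β : MulAut G) :
    autRep G β (eChar h φ) =
      (φ (MulAut.characteristic (Subgroup.zpowers h) β) : ℂ) • eChar h φ := by
  have := Fintype.ofFinite (MulAut (Subgroup.zpowers h))
  rw [eChar_eq_sum, map_sum, Finset.smul_sum]
  refine Fintype.sum_equiv (Equiv.mulLeft (MulAut.characteristic (Subgroup.zpowers h) β)) _ _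
    fun α => ?_
  rw [map_smul, autRep_primIdem hM, smul_smul]
  congr 1
  -- After the substitution α ↦ β|α, the factor φ(β|) cancels against φ((β|α)⁻¹).
  rw [Equiv.coe_mulLeft, mul_inv_rev, mul_comm' α⁻¹, map_mul, Units.val_mul,
    ← mul_assoc, ← Units.val_mul, ← map_mul, mul_inv_cancel, map_one, Units.val_one, one_mul]

end EChar

/-! ### Subgroups of cyclic `p`-groups -/

section PGroup

variable {G : Type u} [Group G] [Finite G] [IsCyclic G] {p k : ℕ} (hp : p.Prime)
  (hG : Nat.card G = p ^ k) {h : ℕ → G} (hh : ∀ l < k, orderOf (h l) = p ^ l)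

include hp hG

omit [Finite G] [IsCyclic G] in
theorem exists_orderOf_eq (g : G) : ∃ j ≤ k, orderOf g = p ^ j :=
  (Nat.dvd_prime_pow hp).1 (hG ▸ orderOf_dvd_natCard g)

include hh

theorem le_zpowers_iff_ne_top (hk : 2 ≤ k) (K : Subgroup G) :
    K ≤ Subgroup.zpowers (h (k - 1)) ↔ K ≠ ⊤ := by
  have ho := hh (k - 1) (by omega)
  constructor
  · rintro hK rfl
    have h1 := Nat.card_le_card_of_injective _ (Subgroup.inclusion_injective hK)
    rw [Subgroup.card_top, Nat.card_zpowers, ho, hG] at h1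
    exact absurd h1 (Nat.pow_lt_pow_right hp.one_lt (by omega)).not_ge
  · intro hK g hg
    obtain ⟨j, hj, hcard⟩ := (Nat.dvd_prime_pow hp).1 (hG ▸ K.card_subgroup_dvd_card)
    have hjk : j ≠ k := fun h0 => hK (Subgroup.card_eq_iff_eq_top K |>.1 (by rw [hcard, hG, h0]))
    rw [mem_zpowers_iff_orderOf_dvd, ho]
    have h1 : orderOf g ∣ Nat.card K := by
      rw [← Subgroup.orderOf_mk g hg]
      exact orderOf_dvd_natCard _
    exact h1.trans (hcard ▸ pow_dvd_pow p (by omega))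

theorem zpowers_le_of_ne_bot (hk : 2 ≤ k) (K : Subgroup G) (hK : K ≠ ⊥) :
    Subgroup.zpowers (h 1) ≤ K := by
  obtain ⟨x, hx, hx1⟩ := K.bot_or_exists_ne_one.resolve_left hK
  obtain ⟨j, -, hj⟩ := exists_orderOf_eq hp hG x
  have hj0 : j ≠ 0 := by
    rintro rfl
    exact hx1 (orderOf_eq_one_iff.1 (by rw [hj, pow_zero]))
  have h1 : h 1 ∈ Subgroup.zpowers x := by
    rw [mem_zpowers_iff_orderOf_dvd, hh 1 (by omega), hj]
    exact pow_dvd_pow p (by omega)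
  exact Subgroup.zpowers_le.2 (Subgroup.zpowers_le.2 hx h1)

omit hp hG in
theorem mem_zpowers_one_iff (hk : 2 ≤ k) {x : G} : x ∈ Subgroup.zpowers (h 1) ↔ x ^ p = 1 := by
  rw [mem_zpowers_iff_orderOf_dvd, hh 1 (by omega), pow_one, orderOf_dvd_iff_pow_eq_one]

omit hG [Finite G] [IsCyclic G] in
theorem zpowers_max_ne_bot (hk : 2 ≤ k) : Subgroup.zpowers (h (k - 1)) ≠ ⊥ := by
  rw [Ne, Subgroup.zpowers_eq_bot, ← orderOf_eq_one_iff, hh _ (by omega)]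
  exact (Nat.one_lt_pow (by omega) hp.one_lt).ne'

-- The order of z divides p, so multiplying by z cannot disturb an order divisible by p². Thus a
-- coset of Z outside Z consists of elements of a single order.
omit hG in
theorem orderOf_mul_of_mem (hk : 2 ≤ k) {g z : G} (hg : p ^ 2 ∣ orderOf g)
    (hz : z ∈ Subgroup.zpowers (h 1)) : orderOf (g * z) = orderOf g := by
  have hzp : orderOf z ∣ p := orderOf_dvd_of_pow_eq_one ((mem_zpowers_one_iff hh hk).1 hz)
  rw [mul_comm']
  refine Commute.orderOf_mul_eq_right_of_forall_prime_mul_dvd (mul_comm' z g)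
    (isOfFinOrder_of_finite g) fun r hr hrz => ?_
  rw [(Nat.prime_dvd_prime_iff_eq hr hp).1 (hrz.trans hzp)]
  exact (Nat.mul_dvd_mul_left p hzp).trans (by rwa [← pow_two])

omit hh in
theorem sq_dvd_orderOf_of_notMem (hh : ∀ l < k, orderOf (h l) = p ^ l) (hk : 2 ≤ k) {g : G}
    (hg : g ∉ Subgroup.zpowers (h 1)) : p ^ 2 ∣ orderOf g := by
  obtain ⟨j, -, hj⟩ := exists_orderOf_eq hp hG g
  rw [hj]
  refine pow_dvd_pow p ?_
  by_contra hlt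
  refine hg (mem_zpowers_iff_orderOf_dvd.2 ?_)
  rw [hh 1 (by omega), hj]
  exact pow_dvd_pow p (by omega)

theorem exists_lt_orderOf_eq (hk : 2 ≤ k) {g : G} (hg : g ∈ Subgroup.zpowers (h (k - 1))) :
    ∃ l < k, orderOf g = orderOf (h l) := by
  obtain ⟨j, -, hj⟩ := exists_orderOf_eq hp hG g
  have h1 := mem_zpowers_iff_orderOf_dvd.1 hg
  rw [hj, hh _ (by omega), Nat.pow_dvd_pow_iff_le_right hp.one_lt] at h1
  exact ⟨j, by omega, by rw [hj, hh j (by omega)]⟩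

omit hp hG in
theorem mem_zpowers_of_le {l m : ℕ} (hlm : l ≤ m) (hm : m < k) :
    h l ∈ Subgroup.zpowers (h m) := by
  rw [mem_zpowers_iff_orderOf_dvd, hh l (by omega), hh m hm]
  exact pow_dvd_pow p hlm

omit hG [IsCyclic G] in
theorem card_quotient_lt (hk : 2 ≤ k) :
    Nat.card (G ⧸ Subgroup.zpowers (h 1)) < Nat.card G := by
  rw [Subgroup.card_eq_card_quotient_mul_card_subgroup (Subgroup.zpowers (h 1)),
    Nat.card_zpowers, hh 1 (by omega), pow_one]
  exact lt_mul_of_one_lt_right Nat.card_pos hp.one_lt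

/-- The restriction kernel in terms of species. -/
theorem mem_restrictionKernel_iff (hk : 2 ≤ k) [Fintype (Subgroup.zpowers (h 1))]
    {x : MonBurnside G} :
    x ∈ restrictionKernel p G ↔ x ∈ eTildeKerLin G ∧
      ∀ g, ∑ z : Subgroup.zpowers (h 1), species (⊤ : Subgroup G) (g * z) x = 0 := by
  have hM := le_zpowers_iff_ne_top hp hG hh hk
  have hZ := zpowers_le_of_ne_bot hp hG hh hk
  have hMb := zpowers_max_ne_bot hp hh hk
  have hMt : Subgroup.zpowers (h (k - 1)) ≠ ⊤ := (hM _).1 le_rfl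
  rw [mem_eTildeKerLin_iff hM]
  constructor
  · rintro ⟨h1, h2⟩
    have htop : x ∈ topSpace G := by
      -- G itself, as an (M, G)-biset, is restriction to M.
      refine mem_topSpace_of_restrict_eq_zero hM (h2 _ ?_ ?_ G)
      · exact (IsPGroup.of_card hG).to_subgroup _
      · refine lt_of_le_of_ne (Subgroup.card_le_card_group _) fun h0 => hMt ?_
        exact (Subgroup.card_eq_iff_eq_top _).1 h0
    refine ⟨⟨htop, fun g hg => species_top_eq_zero_of_mem_kerLin hM h1 hg⟩, ?_⟩
    refine sum_species_of_deflation_eq_zero hM (hZ _ hMb) htop ?_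
    exact h2 _ ((IsPGroup.of_card hG).to_quotient _) (card_quotient_lt hp hh hk) _
  · rintro ⟨⟨h1, h2⟩, h3⟩
    exact ⟨mem_kerLin_of_mem_topSpace hM h1 h2, fun H _ _ _ hH U _ _ _ _ =>
      bisetAct_eq_zero_of_sum_species hM hMb hZ h1 h3 hH U⟩

theorem deflation_eq_zero_iff (hk : 2 ≤ k) [Fintype (Subgroup.zpowers (h 1))]
    {x : MonBurnside G} (hx : x ∈ topSpace G) :
    deflation (Subgroup.zpowers (h 1)) x = 0 ↔
      ∀ g, ∑ z : Subgroup.zpowers (h 1), species (⊤ : Subgroup G) (g * z) x = 0 := by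
  have hM := le_zpowers_iff_ne_top hp hG hh hk
  have hZ := zpowers_le_of_ne_bot hp hG hh hk
  have hMb := zpowers_max_ne_bot hp hh hk
  exact ⟨sum_species_of_deflation_eq_zero hM (hZ _ hMb) hx, fun h3 =>
    bisetAct_eq_zero_of_sum_species hM hMb hZ hx h3 (card_quotient_lt hp hh hk) _⟩

theorem restrictionKernel_eq (hk : 2 ≤ k) : restrictionKernel p G =
    eTildeKerLin G ⊓ LinearMap.ker (deflation (Subgroup.zpowers (h 1))) := by
  have := Fintype.ofFinite (Subgroup.zpowers (h 1))
  have hM := le_zpowers_iff_ne_top hp hG hh hk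
  ext x
  rw [mem_restrictionKernel_iff hp hG hh hk, Submodule.mem_inf, LinearMap.mem_ker]
  refine and_congr_right fun hx => ?_
  rw [deflation_eq_zero_iff hp hG hh hk ((mem_eTildeKerLin_iff hM).1 hx).1]

end PGroup

/-! ### The restriction kernel of a cyclic `p`-group -/

theorem ker_inf_eq_bot_iff_of_card_prime {A B : Type*} [Group A] [Group B] {p : ℕ} (hp : p.Prime)
    (φ : A →* B) {S : Subgroup A} (hS : Nat.card S = p) :
    φ.ker ⊓ S = ⊥ ↔ ∃ a ∈ S, φ a ≠ 1 := by
  have : Fact (Nat.card S).Prime := ⟨hS.symm ▸ hp⟩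
  constructor
  · intro H
    by_contra! hall
    have hle : S ≤ φ.ker := fun a ha => hall a ha
    rw [inf_eq_right.2 hle] at H
    rw [H, Subgroup.card_bot] at hS
    exact hp.one_lt.ne hS
  · rintro ⟨a, ha, hφ⟩
    rcases (φ.ker.subgroupOf S).eq_bot_or_eq_top_of_prime_card with H | H
    · exact (Subgroup.subgroupOf_eq_bot.1 H).eq_bot
    · exact absurd (Subgroup.subgroupOf_eq_top.1 H ha) hφ

section PGroup

variable {G : Type u} [Group G] [Finite G] [IsCyclic G] {p k : ℕ} (hp : p.Prime)
  (hG : Nat.card G = p ^ k) {h : ℕ → G} (hh : ∀ l < k, orderOf (h l) = p ^ l)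

include hp hh

/-- For a generator `g` of `H_l` with `l ≥ 2`, the automorphisms in `Aut_Z(H_l)` are determined by
the quotient `g⁻¹ γ(g)`, which can be any element of `Z`. -/
theorem exists_autMod_equiv (hk : 2 ≤ k) {l : ℕ} (hl2 : 2 ≤ l) (hl : l < k)
    (α : MulAut (Subgroup.zpowers (h l))) :
    ∃ e : autMod (Subgroup.zpowers (h l)) (Subgroup.zpowers (h 1)) ≃ Subgroup.zpowers (h 1),
      ∀ γ, ((γ.1 * α) ⟨h l, Subgroup.mem_zpowers _⟩ : G) =
        (α ⟨h l, Subgroup.mem_zpowers _⟩ : G) * e γ := by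
  set g : Subgroup.zpowers (h l) := α ⟨h l, Subgroup.mem_zpowers _⟩ with hg
  have hog : orderOf (g : G) = p ^ l := by rw [hg, orderOf_mulAut_apply, hh l hl]
  refine ⟨Equiv.ofBijective (fun γ => ⟨(g : G)⁻¹ * (γ.1 g : G), γ.2 g⟩) ⟨?_, ?_⟩, ?_⟩
  · intro γ δ hγδ
    have h1 : (γ.1 g : G) = δ.1 g := mul_left_cancel (congrArg Subtype.val hγδ)
    refine Subtype.ext (mul_right_cancel (b := α) (mulAut_ext_of_generator h1))
  · rintro ⟨z, hz⟩
    have ho : orderOf ((g : G) * z) = orderOf (h l) := by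
      rw [orderOf_mul_of_mem hp hh hk (hog ▸ pow_dvd_pow p hl2) hz, hog, hh l hl]
    -- δ moves the chosen generator to gz, so δα⁻¹ moves g to gz. Every x in H_l is a power gⁿ, on
    -- which x⁻¹(δα⁻¹)(x) = zⁿ lies in Z.
    obtain ⟨δ, hδ⟩ := exists_mulAut_zpowers ho
    have hval : ((δ * α⁻¹) g : G) = g * z := by
      rw [MulAut.mul_apply, hg, MulAut.inv_apply_self, hδ]
    refine ⟨⟨δ * α⁻¹, fun x => ?_⟩, Subtype.ext ?_⟩
    · have hx : (x : G) ∈ Subgroup.zpowers (g : G) := by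
        rw [mem_zpowers_iff_orderOf_dvd, hog, ← hh l hl]
        exact orderOf_dvd_of_mem_zpowers x.2
      obtain ⟨n, hn⟩ := Subgroup.mem_zpowers_iff.1 hx
      obtain rfl : g ^ n = x := Subtype.ext hn
      rw [map_zpow, Subgroup.coe_zpow, Subgroup.coe_zpow, hval,
        Commute.mul_zpow (mul_comm' (g : G) z) n,
        inv_mul_cancel_left]
      exact zpow_mem hz n
    · change (g : G)⁻¹ * ((δ * α⁻¹) g : G) = z
      rw [hval, inv_mul_cancel_left]
  · intro γ
    exact (mul_inv_cancel_left (g : G) _).symm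

theorem card_autMod (hk : 2 ≤ k) {l : ℕ} (hl2 : 2 ≤ l) (hl : l < k) :
    Nat.card (autMod (Subgroup.zpowers (h l)) (Subgroup.zpowers (h 1))) = p := by
  obtain ⟨e, -⟩ := exists_autMod_equiv hp hh hk hl2 hl 1
  rw [Nat.card_congr e, Nat.card_zpowers, hh 1 (by omega), pow_one]

theorem ker_inf_autMod_eq_bot_iff (hk : 2 ≤ k) {l : ℕ} (hl2 : 2 ≤ l) (hl : l < k)
    (φ : MulAut (Subgroup.zpowers (h l)) →* ℂˣ) :
    φ.ker ⊓ autMod (Subgroup.zpowers (h l)) (Subgroup.zpowers (h 1)) = ⊥ ↔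
      ∃ γ ∈ autMod (Subgroup.zpowers (h l)) (Subgroup.zpowers (h 1)), φ γ ≠ 1 :=
  ker_inf_eq_bot_iff_of_card_prime hp φ (card_autMod hp hh hk hl2 hl)

include hG

/-- The coset of Z through α(h_l) is its orbit under Aut_Z(H_l), so the coset sum is φ(α⁻¹) times
the sum of φ over that group. Cosets of elements of other orders miss the support. -/
theorem sum_species_eChar_eq_zero_iff (hk : 2 ≤ k) [Fintype (Subgroup.zpowers (h 1))] {l : ℕ}
    (hl2 : 2 ≤ l) (hl : l < k) (φ : MulAut (Subgroup.zpowers (h l)) →* ℂˣ) :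
    (∀ g, ∑ z : Subgroup.zpowers (h 1), species (⊤ : Subgroup G) (g * z) (eChar (h l) φ) = 0) ↔
      φ.ker ⊓ autMod (Subgroup.zpowers (h l)) (Subgroup.zpowers (h 1)) = ⊥ := by
  have hM := le_zpowers_iff_ne_top hp hG hh hk
  have := Fintype.ofFinite (autMod (Subgroup.zpowers (h l)) (Subgroup.zpowers (h 1)))
  have key : ∀ α : MulAut (Subgroup.zpowers (h l)), ∑ z : Subgroup.zpowers (h 1),
      species (⊤ : Subgroup G) ((α ⟨h l, Subgroup.mem_zpowers _⟩ : G) * z) (eChar (h l) φ) =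
      (φ α⁻¹ : ℂ) *
        ∑ γ : autMod (Subgroup.zpowers (h l)) (Subgroup.zpowers (h 1)), (φ γ : ℂ) := by
    intro α
    obtain ⟨e, he⟩ := exists_autMod_equiv hp hh hk hl2 hl α
    rw [← Equiv.sum_comp e, ← Equiv.sum_comp (Equiv.inv _), Finset.mul_sum]
    refine Finset.sum_congr rfl fun γ _ => ?_
    rw [← he, species_top_eChar_of_apply_eq hM φ rfl, mul_inv_rev, map_mul, Units.val_mul]
    simp
  rw [ker_inf_autMod_eq_bot_iff hp hh hk hl2 hl]
  constructor
  · intro H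
    by_contra! hφ
    have h1 := (key 1).symm.trans (H _)
    rw [inv_one, map_one, Units.val_one, one_mul,
      Fintype.sum_congr _ (fun _ => (1 : ℂ)) fun γ => by rw [hφ γ γ.2, Units.val_one],
      Finset.sum_const, Finset.card_univ, ← Nat.card_eq_fintype_card, nsmul_one] at h1
    exact cast_card_ne_zero _ h1
  · rintro ⟨γ, hγ, hφ⟩ g
    have hs := sum_apply_subgroup_of_ne_one hγ hφ
    by_cases hg : orderOf g = orderOf (h l)
    · obtain ⟨α, rfl⟩ := exists_mulAut_zpowers hg
      rw [key α, hs, mul_zero]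
    · refine Finset.sum_eq_zero fun z _ => species_top_eChar_of_orderOf_ne hM φ ?_
      intro ho
      have h2 := orderOf_mul_of_mem hp hh hk (g := g * z) (z := z⁻¹)
        (by rw [ho, hh l hl]; exact pow_dvd_pow p hl2) (inv_mem z.2)
      rw [mul_inv_cancel_right, ho] at h2
      exact hg h2

theorem eChar_mem_ker_deflation_iff (hk : 2 ≤ k) {l : ℕ} (hl2 : 2 ≤ l) (hl : l < k)
    (φ : MulAut (Subgroup.zpowers (h l)) →* ℂˣ) :
    eChar (h l) φ ∈ LinearMap.ker (deflation (Subgroup.zpowers (h 1))) ↔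
      φ.ker ⊓ autMod (Subgroup.zpowers (h l)) (Subgroup.zpowers (h 1)) = ⊥ := by
  have := Fintype.ofFinite (Subgroup.zpowers (h 1))
  rw [LinearMap.mem_ker, deflation_eq_zero_iff hp hG hh hk
    (eChar_mem_topSpace (le_zpowers_iff_ne_top hp hG hh hk) _ _),
    sum_species_eChar_eq_zero_iff hp hG hh hk hl2 hl]

theorem linearIndependent_eChar (hk : 2 ≤ k) : LinearIndependent ℂ
    (fun i : Σ l : Fin k, (MulAut (Subgroup.zpowers (h l)) →* ℂˣ) => eChar (h i.1) i.2) := by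
  have hM := le_zpowers_iff_ne_top hp hG hh hk
  have (l : Fin k) := Fintype.ofFinite (MulAut (Subgroup.zpowers (h l)) →* ℂˣ)
  rw [Fintype.linearIndependent_iff]
  rintro c hc ⟨l, φ⟩
  refine eq_zero_of_sum_char_eq_zero (c := fun φ => c ⟨l, φ⟩) (fun α => ?_) φ
  -- Evaluating at α⁻¹(h_l) keeps only level l, since supports at different levels differ by order,
  -- and returns φ(α).
  have h1 := congrArg (species ⊤ ((α⁻¹ ⟨h l, Subgroup.mem_zpowers _⟩ : _) : G)) hc
  rw [map_sum, map_zero, Fintype.sum_sigma, Finset.sum_eq_single l] at h1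
  · rw [← h1]
    refine Finset.sum_congr rfl fun φ _ => ?_
    rw [map_smul, species_top_eChar_of_apply_eq hM φ rfl, inv_inv, smul_eq_mul]
  · intro m _ hm
    refine Finset.sum_eq_zero fun φ _ => ?_
    rw [map_smul, species_top_eChar_of_orderOf_ne hM, smul_zero]
    rw [orderOf_mulAut_apply, hh _ l.2, hh _ m.2]
    exact fun h0 => hm (Fin.ext (Nat.pow_right_injective hp.two_le h0).symm)
  · exact fun h0 => absurd (Finset.mem_univ _) h0

theorem span_eChar (hk : 2 ≤ k) : Submodule.span ℂ (Set.range
    (fun i : Σ l : Fin k, (MulAut (Subgroup.zpowers (h l)) →* ℂˣ) => eChar (h i.1) i.2)) =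
      eTildeKerLin G := by
  have hM := le_zpowers_iff_ne_top hp hG hh hk
  have := Fintype.ofFinite G
  refine le_antisymm ?_ fun x hx => ?_
  · rw [Submodule.span_le]
    rintro _ ⟨⟨l, φ⟩, rfl⟩
    exact eChar_mem_eTildeKerLin hM (mem_zpowers_of_le hh (by omega) (by omega)) φ
  · rw [mem_eTildeKerLin_iff hM] at hx
    rw [eq_sum_primIdem hM hx.1]
    refine Submodule.sum_mem _ fun g _ => ?_
    by_cases hg : g ∈ Subgroup.zpowers (h (k - 1))
    · obtain ⟨l, hl, ho⟩ := exists_lt_orderOf_eq hp hG hh hk hg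
      refine Submodule.smul_mem _ _ (Submodule.span_mono ?_ (primIdem_mem_span_eChar ho))
      rintro _ ⟨φ, rfl⟩
      exact ⟨⟨⟨l, hl⟩, φ⟩, rfl⟩
    · rw [hx.2 g hg, zero_smul]
      exact Submodule.zero_mem _

end PGroup

/-! ### A basis of the restriction kernel -/

section Family

variable {G : Type u} [Group G]

/-- The index set of the basis of the restriction kernel. -/
abbrev KernelIndex (k : ℕ) (h : ℕ → G) : Type u :=
  ({i : Σ l : Fin k, (MulAut (Subgroup.zpowers (h l)) →* ℂˣ) //
      2 ≤ (i.1 : ℕ) ∧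
        i.2.ker ⊓ autMod (Subgroup.zpowers (h i.1)) (Subgroup.zpowers (h 1)) = ⊥} ⊕
    {φ : MulAut (Subgroup.zpowers (h 1)) →* ℂˣ // φ ≠ 1}) ⊕ Unit

/-- The basis of the restriction kernel. -/
def kernelFamily (p k : ℕ) (h : ℕ → G) : KernelIndex k h → MonBurnside G :=
  Sum.elim
    (Sum.elim (fun i => eChar (h i.1.1) i.1.2) (fun φ => eChar (h 1) φ.1))
    (fun _ => eChar (h 1) 1 + (1 - (p : ℂ)) • eChar (h 0) 1)

variable [IsCyclic G]

/-- The characters of `Aut(G)` on the basis vectors of the restriction kernel. -/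
def kernelChar (k : ℕ) (h : ℕ → G) : KernelIndex k h → (MulAut G →* ℂˣ) :=
  Sum.elim
    (Sum.elim (fun i => i.1.2.comp (MulAut.characteristic (Subgroup.zpowers (h i.1.1))))
      (fun φ => φ.1.comp (MulAut.characteristic (Subgroup.zpowers (h 1)))))
    (fun _ => 1)

/-- The support lies inside Z, so only the coset Z itself sees the function, and it sees all its
values. This covers levels 0 and 1. -/
theorem sum_species_eChar_of_le [Finite G] {M : Subgroup G}
    (hM : ∀ K : Subgroup G, K ≤ M ↔ K ≠ ⊤) {c : G} {Z : Subgroup G} [Fintype Z] (hc : c ∈ Z)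
    [Fintype (MulAut (Subgroup.zpowers c))] (φ : MulAut (Subgroup.zpowers c) →* ℂˣ) (g : G)
    [Decidable (g ∈ Z)] :
    ∑ z : Z, species (⊤ : Subgroup G) (g * z) (eChar c φ) =
      if g ∈ Z then ∑ α, (φ α : ℂ) else 0 := by
  classical
  rw [eChar_eq_sum]
  simp_rw [map_sum, map_smul, species_top_primIdem hM]
  rw [Finset.sum_comm]
  have hα : ∀ α : MulAut (Subgroup.zpowers c), (α ⟨c, Subgroup.mem_zpowers c⟩ : G) ∈ Z :=
    fun α => Subgroup.zpowers_le.2 hc (α ⟨c, Subgroup.mem_zpowers c⟩).2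
  split_ifs with hg
  · rw [← Equiv.sum_comp (Equiv.inv _)]
    refine Finset.sum_congr rfl fun α _ => ?_
    rw [Finset.sum_eq_single ⟨g⁻¹ * _, Z.mul_mem (Z.inv_mem hg) (hα (Equiv.inv _ α))⟩]
    · simp
    · intro z _ hz
      rw [if_neg, smul_zero]
      intro h0
      exact hz (Subtype.ext (eq_inv_mul_of_mul_eq h0.symm))
    · exact fun h0 => absurd (Finset.mem_univ _) h0
  · refine Finset.sum_eq_zero fun α _ => Finset.sum_eq_zero fun z _ => ?_
    rw [if_neg, smul_zero]
    intro h0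
    refine hg ?_
    rw [← mul_inv_cancel_right g (z : G), ← h0]
    exact Z.mul_mem (hα α) (Z.inv_mem z.2)

end Family

/-! ### Eigenvectors in the restriction kernel and their span -/

section PGroup

variable {G : Type u} [Group G] [Finite G] [IsCyclic G] {p k : ℕ} (hp : p.Prime)
  (hG : Nat.card G = p ^ k) {h : ℕ → G} (hh : ∀ l < k, orderOf (h l) = p ^ l)

include hp hG hh

theorem autRep_kernelFamily (hk : 2 ≤ k) (i : KernelIndex k h) (β : MulAut G) :
    autRep G β (kernelFamily p k h i) = (kernelChar k h i β : ℂ) • kernelFamily p k h i := by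
  have hM := le_zpowers_iff_ne_top hp hG hh hk
  rcases i with (i | φ) | i
  · exact autRep_eChar hM _ _ β
  · exact autRep_eChar hM _ _ β
  · change autRep G β (eChar (h 1) 1 + (1 - (p : ℂ)) • eChar (h 0) 1) =
      ((1 : ℂˣ) : ℂ) • (eChar (h 1) 1 + (1 - (p : ℂ)) • eChar (h 0) 1)
    rw [map_add, map_smul, autRep_eChar hM, autRep_eChar hM]
    simp

theorem kernelFamily_ne_zero (hk : 2 ≤ k) (i : KernelIndex k h) : kernelFamily p k h i ≠ 0 := by
  have hM := le_zpowers_iff_ne_top hp hG hh hk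
  have key : ∀ l, ∀ φ : MulAut (Subgroup.zpowers (h l)) →* ℂˣ,
      species ⊤ (h l) (eChar (h l) φ) = 1 := by
    intro l φ
    refine (species_top_eChar_of_apply_eq hM φ (α := 1) rfl).trans ?_
    simp
  rcases i with (i | φ) | i
  · intro h0
    have h1 := key i.1.1 i.1.2
    rw [show eChar (h i.1.1) i.1.2 = 0 from h0, map_zero] at h1
    exact zero_ne_one h1
  · intro h0
    have h1 := key 1 φ.1
    rw [show eChar (h 1) φ.1 = 0 from h0, map_zero] at h1
    exact zero_ne_one h1
  · intro h0
    have h1 := congrArg (species ⊤ (h 1)) h0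
    change species ⊤ (h 1) (eChar (h 1) 1 + (1 - (p : ℂ)) • eChar (h 0) 1) = _ at h1
    rw [map_add, map_smul, key 1, species_top_eChar_of_orderOf_ne hM, map_zero, smul_zero,
      add_zero] at h1
    · exact one_ne_zero h1
    · rw [hh 1 (by omega), hh 0 (by omega), pow_one, pow_zero]
      exact hp.one_lt.ne'

omit hG [IsCyclic G] in
theorem card_mulAut_zpowers (hk : 2 ≤ k) :
    (Nat.card (MulAut (Subgroup.zpowers (h 1))) : ℂ) = p - 1 ∧
      (Nat.card (MulAut (Subgroup.zpowers (h 0))) : ℂ) = 1 := by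
  rw [IsCyclic.card_mulAut, IsCyclic.card_mulAut, Nat.card_zpowers, Nat.card_zpowers,
    hh 1 (by omega), hh 0 (by omega), pow_one, pow_zero, Nat.totient_prime hp, Nat.totient_one,
    Nat.cast_sub hp.one_le, Nat.cast_one]
  exact ⟨rfl, rfl⟩

theorem kernelFamily_mem (hk : 2 ≤ k) (i : KernelIndex k h) :
    kernelFamily p k h i ∈ restrictionKernel p G := by
  classical
  have hM := le_zpowers_iff_ne_top hp hG hh hk
  have := Fintype.ofFinite (Subgroup.zpowers (h 1))
  have (l : ℕ) := Fintype.ofFinite (MulAut (Subgroup.zpowers (h l)))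
  have hmem : ∀ l < k, ∀ φ : MulAut (Subgroup.zpowers (h l)) →* ℂˣ,
      eChar (h l) φ ∈ eTildeKerLin G := fun l hl φ =>
    eChar_mem_eTildeKerLin hM (mem_zpowers_of_le hh (by omega) (by omega)) φ
  rw [mem_restrictionKernel_iff hp hG hh hk]
  rcases i with (⟨⟨l, φ⟩, hl2, hφ⟩ | ⟨φ, hφ⟩) | i
  · exact ⟨hmem l l.2 φ, (sum_species_eChar_eq_zero_iff hp hG hh hk hl2 l.2 φ).2 hφ⟩
  · refine ⟨hmem 1 (by omega) φ, fun g => ?_⟩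
    change ∑ z : Subgroup.zpowers (h 1), species (⊤ : Subgroup G) (g * z) (eChar (h 1) φ) = 0
    rw [sum_species_eChar_of_le hM (Subgroup.mem_zpowers _), sum_apply_of_ne_one hφ, ite_self]
  · refine ⟨Submodule.add_mem _ (hmem 1 (by omega) 1)
      (Submodule.smul_mem _ _ (hmem 0 (by omega) 1)), fun g => ?_⟩
    change ∑ z : Subgroup.zpowers (h 1), species (⊤ : Subgroup G) (g * z)
      (eChar (h 1) 1 + (1 - (p : ℂ)) • eChar (h 0) 1) = 0
    simp_rw [map_add, map_smul]
    rw [Finset.sum_add_distrib, ← Finset.smul_sum,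
      sum_species_eChar_of_le hM (Subgroup.mem_zpowers _),
      sum_species_eChar_of_le hM (mem_zpowers_of_le hh (by omega) (by omega))]
    obtain ⟨h1, h0⟩ := card_mulAut_zpowers hp hh hk
    split_ifs
    -- On Z the sum is |Aut(H_1)| + (1 - p)|Aut(H_0)| = (p - 1) + (1 - p) = 0.
    · simp only [MonoidHom.one_apply, Units.val_one, Finset.sum_const, Finset.card_univ,
        ← Nat.card_eq_fintype_card, nsmul_one, h1, h0, smul_eq_mul]
      ring
    · simp

/-- If the species of `x ∈ ẽ_G^G 𝕊_p(G)` are constant on the cosets of `Z` outside of `Z` and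
vanish on `Z \ {1}`, then `x` cannot lie in the restriction kernel unless it is zero. -/
theorem eq_zero_of_mem_restrictionKernel (hk : 2 ≤ k) {x : MonBurnside G}
    (hx : x ∈ restrictionKernel p G)
    (h1 : ∀ g ∉ Subgroup.zpowers (h 1), ∀ z ∈ Subgroup.zpowers (h 1),
      species (⊤ : Subgroup G) (g * z) x = species ⊤ g x)
    (h2 : ∀ z ∈ Subgroup.zpowers (h 1), z ≠ 1 → species ⊤ z x = 0) : x = 0 := by
  have hM := le_zpowers_iff_ne_top hp hG hh hk
  have := Fintype.ofFinite (Subgroup.zpowers (h 1))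
  rw [mem_restrictionKernel_iff hp hG hh hk, mem_eTildeKerLin_iff hM] at hx
  refine ext_topSpace hx.1.1 (Submodule.zero_mem _) fun g => ?_
  rw [map_zero]
  by_cases hg : g ∈ Subgroup.zpowers (h 1)
  · by_cases hg1 : g = 1
    · rw [hg1, ← hx.2 1, Finset.sum_eq_single 1]
      · simp
      · intro z _ hz
        rw [one_mul]
        exact h2 z z.2 fun h0 => hz (Subtype.ext h0)
      · exact fun h0 => absurd (Finset.mem_univ _) h0
    · exact h2 g hg hg1
  · have h3 := hx.2 g
    rw [Fintype.sum_congr _ (fun _ => species ⊤ g x)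
      fun z : Subgroup.zpowers (h 1) => h1 g hg z z.2, Finset.sum_const, Finset.card_univ,
      ← Nat.card_eq_fintype_card, ← Nat.cast_smul_eq_nsmul ℂ, smul_eq_zero] at h3
    exact h3.resolve_left (cast_card_ne_zero _)

theorem span_kernelFamily (hk : 2 ≤ k) :
    Submodule.span ℂ (Set.range (kernelFamily p k h)) = restrictionKernel p G := by
  classical
  have hM := le_zpowers_iff_ne_top hp hG hh hk
  refine le_antisymm (Submodule.span_le.2 ?_) fun x hx => ?_
  · rintro _ ⟨i, rfl⟩
    exact kernelFamily_mem hp hG hh hk i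
  -- W meets the restriction kernel trivially within ẽ_G^G 𝕊_p(G), while every e_{G,l,φ} lies in W
  -- plus the span of the family. The W-component of an element of the kernel is again in the
  -- kernel, hence zero.
  let W : Submodule ℂ (MonBurnside G) :=
    { carrier := {x | (∀ g ∉ Subgroup.zpowers (h 1), ∀ z ∈ Subgroup.zpowers (h 1),
          species (⊤ : Subgroup G) (g * z) x = species ⊤ g x) ∧
        ∀ z ∈ Subgroup.zpowers (h 1), z ≠ 1 → species ⊤ z x = 0}
      zero_mem' := ⟨fun g _ z _ => by rw [map_zero, map_zero], fun z _ _ => map_zero _⟩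
      add_mem' := fun {x y} hx hy =>
        ⟨fun g hg z hz => by rw [map_add, map_add, hx.1 g hg z hz, hy.1 g hg z hz],
          fun z hz hz1 => by rw [map_add, hx.2 z hz hz1, hy.2 z hz hz1, add_zero]⟩
      smul_mem' := fun c x hx =>
        ⟨fun g hg z hz => by rw [map_smul, map_smul, hx.1 g hg z hz],
          fun z hz hz1 => by rw [map_smul, hx.2 z hz hz1, smul_zero]⟩ }
  have hZord : ∀ z ∈ Subgroup.zpowers (h 1), ∀ l, 2 ≤ l → l < k → orderOf z ≠ orderOf (h l) := by
    intro z hz l hl2 hl h0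
    have h1 := orderOf_dvd_of_mem_zpowers hz
    rw [h0, hh l hl, hh 1 (by omega), Nat.pow_dvd_pow_iff_le_right hp.one_lt] at h1
    omega
  have hW0 : ∀ φ, eChar (h 0) φ ∈ W := by
    have hne : ∀ g : G, g ≠ 1 → orderOf g ≠ orderOf (h 0) := by
      intro g hg
      rwa [hh 0 (by omega), pow_zero, Ne, orderOf_eq_one_iff]
    refine fun φ => ⟨fun g hg z hz => ?_, fun z _ hz1 =>
      species_top_eChar_of_orderOf_ne hM φ (hne z hz1)⟩
    rw [species_top_eChar_of_orderOf_ne hM φ (hne g fun h0 => hg (h0 ▸ one_mem _)),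
      species_top_eChar_of_orderOf_ne hM φ (hne _ fun h0 => hg ?_)]
    rw [eq_inv_of_mul_eq_one_left h0]
    exact inv_mem hz
  have hW2 : ∀ l, 2 ≤ l → l < k → ∀ φ : MulAut (Subgroup.zpowers (h l)) →* ℂˣ,
      φ.ker ⊓ autMod (Subgroup.zpowers (h l)) (Subgroup.zpowers (h 1)) ≠ ⊥ →
        eChar (h l) φ ∈ W := by
    intro l hl2 hl φ hφ
    rw [Ne, ker_inf_autMod_eq_bot_iff hp hh hk hl2 hl] at hφ
    push Not at hφ
    refine ⟨fun g hg z hz => ?_, fun z hz _ =>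
      species_top_eChar_of_orderOf_ne hM φ (hZord z hz l hl2 hl)⟩
    by_cases ho : orderOf g = orderOf (h l)
    · obtain ⟨α, rfl⟩ := exists_mulAut_zpowers ho
      obtain ⟨e, he⟩ := exists_autMod_equiv hp hh hk hl2 hl α
      have h1 := he (e.symm ⟨z, hz⟩)
      rw [e.apply_symm_apply] at h1
      rw [species_top_eChar_of_apply_eq hM φ h1, species_top_eChar_of_apply_eq hM φ rfl,
        mul_inv_rev, map_mul, map_inv φ (e.symm ⟨z, hz⟩ : MulAut _), hφ _ (e.symm ⟨z, hz⟩).2,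
        inv_one, mul_one]
    · rw [species_top_eChar_of_orderOf_ne hM φ ho, species_top_eChar_of_orderOf_ne hM φ]
      rwa [orderOf_mul_of_mem hp hh hk (sq_dvd_orderOf_of_notMem hp hG hh hk hg) hz]
  have hspan : eTildeKerLin G ≤ Submodule.span ℂ (Set.range (kernelFamily p k h)) ⊔ W := by
    rw [← span_eChar hp hG hh hk, Submodule.span_le]
    rintro _ ⟨⟨⟨l, hl⟩, φ⟩, rfl⟩
    have hb : ∀ i, kernelFamily p k h i ∈
        Submodule.span ℂ (Set.range (kernelFamily p k h)) ⊔ W := fun i =>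
      Submodule.mem_sup_left (Submodule.subset_span ⟨i, rfl⟩)
    rcases lt_trichotomy l 1 with hl1 | rfl | hl2
    · obtain rfl : l = 0 := by omega
      exact Submodule.mem_sup_right (hW0 φ)
    · by_cases hφ : φ = 1
      · have h1 := Submodule.sub_mem _ (hb (Sum.inr ()))
          (Submodule.mem_sup_right (Submodule.smul_mem _ (1 - (p : ℂ)) (hW0 1)))
        change eChar (h 1) 1 + (1 - (p : ℂ)) • eChar (h 0) 1 - (1 - (p : ℂ)) • eChar (h 0) 1 ∈ _
          at h1
        rw [add_sub_cancel_right] at h1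
        rw [hφ]
        exact h1
      · exact hb (Sum.inl (Sum.inr ⟨φ, hφ⟩))
    · by_cases hφ : φ.ker ⊓ autMod (Subgroup.zpowers (h l)) (Subgroup.zpowers (h 1)) = ⊥
      · exact hb (Sum.inl (Sum.inl ⟨⟨⟨l, hl⟩, φ⟩, hl2, hφ⟩))
      · exact Submodule.mem_sup_right (hW2 l hl2 hl φ hφ)
  have hx' := hspan ((restrictionKernel_eq hp hG hh hk).le hx).1
  obtain ⟨y, hy, w, hw, rfl⟩ := Submodule.mem_sup.1 hx'
  have hyK : y ∈ restrictionKernel p G := by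
    refine Submodule.span_le.2 ?_ hy
    rintro _ ⟨i, rfl⟩
    exact kernelFamily_mem hp hG hh hk i
  have hwK : w ∈ restrictionKernel p G := by
    have := Submodule.sub_mem _ hx hyK
    rwa [add_sub_cancel_left] at this
  rw [eq_zero_of_mem_restrictionKernel hp hG hh hk hwK hw.1 hw.2, add_zero]
  exact hy

end PGroup

/-! ### Linear characters as representations -/

section Representation

variable {A : Type*} [Group A]

theorem charRep_apply (χ : A →* ℂˣ) (a : A) (v : ℂ) : charRep χ a v = (χ a : ℂ) * v := rfl

/-- Eigenvectors for distinct characters are linearly independent. -/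
theorem linearIndependent_of_char {ι V : Type*} [AddCommGroup V] [Module ℂ V]
    (ρ : Representation ℂ A V) {χ : ι → A →* ℂˣ} (hχ : Function.Injective χ) {v : ι → V}
    (hv : ∀ i a, ρ a (v i) = (χ i a : ℂ) • v i) (hv0 : ∀ i, v i ≠ 0) : LinearIndependent ℂ v := by
  rw [linearIndependent_iff']
  intro s c hc i hi
  -- Applying f after ρ(a) turns the vector relation into a relation between characters, to which
  -- Dedekind's theorem applies.
  obtain ⟨f, hf⟩ : ∃ f : Module.Dual ℂ V, f (v i) ≠ 0 := by
    by_contra! h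
    exact hv0 i ((Module.forall_dual_apply_eq_zero_iff ℂ (v i)).1 h)
  have h1 := linearIndependent_iff'.1 ((linearIndependent_char A).comp χ hχ) s
    (fun j => c j * f (v j)) (by
      funext a
      have h2 := congrArg (fun w => f (ρ a w)) hc
      simp only [map_sum, map_smul, hv, map_zero, smul_eq_mul] at h2
      rw [Finset.sum_apply, Pi.zero_apply, ← h2]
      refine Finset.sum_congr rfl fun j _ => ?_
      simp only [Function.comp_apply, Pi.smul_apply, smul_eq_mul]
      ring) i hi
  exact (mul_eq_zero.1 h1).resolve_right hf

theorem isIrreducible_of_finrank_eq_one {V : Type*} [AddCommGroup V] [Module ℂ V]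
    (ρ : Representation ℂ A V) (h : Module.finrank ℂ V = 1) : ρ.IsIrreducible := by
  have hs : IsSimpleOrder (Submodule ℂ V) :=
    (isSimpleModule_iff ℂ V).1 (isSimpleModule_iff_finrank_eq_one.2 h)
  have hbot : (⊥ : Subrepresentation ρ).toSubmodule = ⊥ := rfl
  have htop : (⊤ : Subrepresentation ρ).toSubmodule = ⊤ := rfl
  refine { exists_pair_ne := ⟨⊥, ⊤, fun h0 => ?_⟩, eq_bot_or_eq_top := fun W => ?_ }
  · exact bot_ne_top (hbot.symm.trans ((congrArg _ h0).trans htop))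
  · rcases hs.eq_bot_or_eq_top W.toSubmodule with h0 | h0
    · exact Or.inl (Subrepresentation.toSubmodule_injective (h0.trans hbot.symm))
    · exact Or.inr (Subrepresentation.toSubmodule_injective (h0.trans htop.symm))

theorem charRep_isIrreducible (χ : A →* ℂˣ) : (charRep χ).IsIrreducible :=
  isIrreducible_of_finrank_eq_one _ (Module.finrank_self ℂ)

/-- The finite orbit of a nonzero vector spans a nonzero invariant subspace, hence everything. -/
theorem finiteDimensional_of_isIrreducible [Finite A] {V : Type*} [AddCommGroup V] [Module ℂ V]
    (σ : Representation ℂ A V) (hσ : σ.IsIrreducible) : FiniteDimensional ℂ V := by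
  have htop : (⊤ : Subrepresentation σ).toSubmodule = ⊤ := rfl
  have hbot : (⊥ : Subrepresentation σ).toSubmodule = ⊥ := rfl
  obtain ⟨v, hv⟩ : ∃ v : V, v ≠ 0 := by
    by_contra! h
    refine hσ.bot_ne_top (Subrepresentation.toSubmodule_injective ?_)
    rw [htop, hbot, eq_comm, Submodule.eq_bot_iff]
    exact fun x _ => h x
  let W : Subrepresentation σ :=
    { toSubmodule := Submodule.span ℂ (Set.range fun a => σ a v)
      apply_mem_toSubmodule := fun a w hw => by
        have : Submodule.span ℂ (Set.range fun a => σ a v) ≤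
            (Submodule.span ℂ (Set.range fun a => σ a v)).comap (σ a) := by
          rw [Submodule.span_le]
          rintro _ ⟨b, rfl⟩
          refine Submodule.subset_span ⟨a * b, ?_⟩
          change σ (a * b) v = _
          rw [map_mul]
          rfl
        exact this hw }
  have hvW : v ∈ W.toSubmodule := Submodule.subset_span ⟨1, by change σ 1 v = v; rw [map_one]; rfl⟩
  have hW : W.toSubmodule = ⊤ := by
    rcases hσ.eq_bot_or_eq_top W with h0 | h0
    · rw [h0, hbot] at hvW
      exact absurd ((Submodule.mem_bot ℂ).1 hvW) hv
    · rw [h0, htop]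
  rw [FiniteDimensional, Module.finite_def, ← hW]
  exact Submodule.fg_span (Set.finite_range _)

theorem existsUnique_charRep_equiv [Finite A] [IsMulCommutative A] {V : Type*} [AddCommGroup V]
    [Module ℂ V] (σ : Representation ℂ A V) (hσ : σ.IsIrreducible) :
    ∃! χ : A →* ℂˣ, Nonempty (σ.Equiv (charRep χ)) := by
  have := finiteDimensional_of_isIrreducible σ hσ
  have h1 : Module.finrank ℂ V = 1 :=
    Representation.IsIrreducible.finrank_eq_one_of_isMulCommutative σ
  let e : V ≃ₗ[ℂ] ℂ := LinearEquiv.ofFinrankEq V ℂ (h1.trans (Module.finrank_self ℂ).symm)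
  -- On a line σ(a) is a scalar; this reads it off at the vector with coordinate 1.
  have hs : ∀ a v, e (σ a v) = e (σ a (e.symm 1)) * e v := by
    intro a v
    have hv : v = e v • e.symm 1 := by
      rw [← map_smul, smul_eq_mul, mul_one, e.symm_apply_apply]
    conv_lhs => rw [hv, map_smul, map_smul, smul_eq_mul, mul_comm]
  let f : A →* ℂ :=
    { toFun := fun a => e (σ a (e.symm 1))
      map_one' := by rw [map_one, Module.End.one_apply, e.apply_symm_apply]
      map_mul' := fun a b => by rw [map_mul, Module.End.mul_apply, hs] }
  refine ⟨f.toHomUnits, ⟨Representation.Equiv.mk e fun a => LinearMap.ext fun v => hs a v⟩, ?_⟩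
  rintro χ ⟨E⟩
  ext a
  have h2 : E (σ a (e.symm 1)) = (χ a : ℂ) * E (e.symm 1) :=
    DFunLike.congr_fun (E.isIntertwining' a) (e.symm 1)
  have h3 : σ a (e.symm 1) = e (σ a (e.symm 1)) • e.symm 1 := by
    rw [← map_smul, smul_eq_mul, mul_one, e.symm_apply_apply]
  rw [h3, map_smul, smul_eq_mul] at h2
  have h4 : E (e.symm 1) ≠ 0 := by
    intro h0
    rw [map_eq_zero_iff E (EquivLike.injective E), map_eq_zero_iff e.symm e.symm.injective] at h0
    exact one_ne_zero h0
  exact (mul_right_cancel₀ h4 h2).symm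

/-- A representation with a basis of eigenvectors whose characters are distinct and are exactly
the elements of `S` is the direct sum of the representations given by the elements of `S`. -/
theorem nonempty_equiv_directSum_charRep {ι V : Type*} [AddCommGroup V] [Module ℂ V]
    (ρ : Representation ℂ A V) (b : Module.Basis ι ℂ V) {S : (A →* ℂˣ) → Prop}
    (c : ι ≃ {χ // S χ}) (hb : ∀ i a, ρ a (b i) = ((c i).1 a : ℂ) • b i) :
    Nonempty (ρ.Equiv (Representation.directSum fun χ : {χ : A →* ℂˣ // S χ} => charRep χ.1)) := by
  classical
  let e : V ≃ₗ[ℂ] (⨁ _ : {χ : A →* ℂˣ // S χ}, ℂ) :=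
    (b.reindex c).repr.trans (finsuppLEquivDirectSum ℂ ℂ _)
  have he : ∀ i, e (b i) = DirectSum.lof ℂ _ (fun _ => ℂ) (c i) 1 := by
    intro i
    have : b i = b.reindex c (c i) := by simp
    rw [this]
    simp only [e, LinearEquiv.trans_apply, Module.Basis.repr_self, finsuppLEquivDirectSum_single]
  refine ⟨Representation.Equiv.mk e fun a => b.ext fun i => ?_⟩
  rw [LinearMap.comp_apply, LinearMap.comp_apply, hb, map_smul]
  change _ • e (b i) = DirectSum.lmap (fun χ : {χ : A →* ℂˣ // S χ} => charRep χ.1 a) (e (b i))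
  rw [he, DirectSum.lmap_lof, charRep_apply, ← map_smul, smul_eq_mul]

/-- The analogue of `nonempty_equiv_directSum_charRep` for subrepresentations. -/
theorem nonempty_subrepresentation_equiv {A ι V : Type*} [Group A] [AddCommGroup V] [Module ℂ V]
    (ρ : Representation ℂ A V) {W : Submodule ℂ V} (hW : ∀ a, W ≤ W.comap (ρ a)) {v : ι → V}
    (hv : LinearIndependent ℂ v) (hspan : Submodule.span ℂ (Set.range v) = W)
    {S : (A →* ℂˣ) → Prop} (c : ι ≃ {χ // S χ})
    (hb : ∀ i a, ρ a (v i) = ((c i).1 a : ℂ) • v i) :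
    Nonempty ((ρ.subrepresentation W hW).Equiv
      (Representation.directSum fun χ : {χ : A →* ℂˣ // S χ} => charRep χ.1)) := by
  subst hspan
  refine nonempty_equiv_directSum_charRep _ (Module.Basis.span hv) c fun i a => Subtype.ext ?_
  change ρ a (Module.Basis.span hv i : V) = _ • (Module.Basis.span hv i : V)
  rw [Module.Basis.span_apply, hb]

end Representation

/-! ### The characters on the restriction kernel -/

section Primitive

variable {G : Type u} [Group G] [Finite G] [IsCyclic G]

/-- A proper divisor of p^k divides p^(k-1), so non-primitive means factoring through (ℤ/p^(k-1))ˣ,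
and a unit is 1 modulo the order of c iff the automorphism it defines fixes c. -/
theorem not_isPrimitiveChar_iff {p k : ℕ} (hp : p.Prime) (hG : Nat.card G = p ^ k) {c : G}
    (hk : k ≠ 0) (hc : orderOf c = p ^ (k - 1)) (χ : MulAut G →* ℂˣ) :
    ¬ IsPrimitiveChar χ ↔ ∀ β : MulAut G, β c = c → χ β = 1 := by
  have : NeZero (Nat.card G) := ⟨Nat.card_pos.ne'⟩
  set ψ : DirichletCharacter ℂ (Nat.card G) :=
    MulChar.ofUnitHom (χ.comp (IsCyclic.mulAutMulEquiv G).symm.toMonoidHom) with hψ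
  have hd : orderOf c ∣ Nat.card G := orderOf_dvd_natCard c
  have hlt : orderOf c < Nat.card G := by
    rw [hc, hG]
    exact Nat.pow_lt_pow_right hp.one_lt (by omega)
  have h1 : ¬ IsPrimitiveChar χ ↔ ψ.FactorsThrough (orderOf c) := by
    change ¬ ψ.conductor = Nat.card G ↔ _
    constructor
    · intro hne
      have h2 : ψ.conductor ∣ orderOf c := by
        have hdv : ψ.conductor ∣ p ^ k := by
          rw [← hG]
          exact ψ.conductor_dvd_level
        obtain ⟨j, hj, h3⟩ := (Nat.dvd_prime_pow hp).1 hdv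
        rw [h3, hc]
        refine pow_dvd_pow p ?_
        have : j ≠ k := fun h0 => hne (by rw [h3, hG, h0])
        omega
      exact DirichletCharacter.FactorsThrough.mono _ ψ.factorsThrough_conductor h2 hd
    · intro hf h0
      have h3 : ψ.conductor ≤ orderOf c := Nat.sInf_le hf
      omega
  rw [h1, DirichletCharacter.factorsThrough_iff_ker_unitsMap hd]
  have hunit : ∀ β, ψ.toUnitHom (IsCyclic.mulAutMulEquiv G β) = χ β := by
    intro β
    rw [hψ, MulChar.toUnitHom_eq, MulChar.ofUnitHom_eq, Equiv.apply_symm_apply]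
    simp
  have hker : ∀ β, IsCyclic.mulAutMulEquiv G β ∈ (ZMod.unitsMap hd).ker ↔ β c = c := by
    intro β
    rw [MonoidHom.mem_ker, mulAut_apply_eq_pow, Units.ext_iff, ZMod.unitsMap_def, Units.coe_map,
      Units.val_one]
    conv_rhs =>
      rw [← pow_one c, ← pow_mul, one_mul, pow_eq_pow_iff_modEq, ← ZMod.natCast_eq_natCast_iff]
    rw [ZMod.natCast_val, Nat.cast_one]
    rfl
  constructor
  · intro H β hβ
    have := H ((hker β).2 hβ)
    rwa [MonoidHom.mem_ker, hunit] at this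
  · intro H u hu
    obtain ⟨β, rfl⟩ := (IsCyclic.mulAutMulEquiv G).surjective u
    rw [MonoidHom.mem_ker, hunit]
    exact H β ((hker β).1 hu)

end Primitive

/-! ### Non-primitive characters as inflations from the groups Aut(H_l) -/

section PGroup

variable {G : Type u} [Group G] [Finite G] [IsCyclic G] {p k : ℕ} (hp : p.Prime)
  (hG : Nat.card G = p ^ k) {h : ℕ → G} (hh : ∀ l < k, orderOf (h l) = p ^ l)

include hh

theorem mulAut_fix_of_le {l m : ℕ} (hlm : l ≤ m) (hm : m < k) {β : MulAut G}
    (hβ : β (h m) = h m) : β (h l) = h l := by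
  obtain ⟨n, hn⟩ := Subgroup.mem_zpowers_iff.1 (mem_zpowers_of_le hh hlm hm)
  rw [← hn, map_zpow, hβ]

/-- `Aut_Z(H_l)` is the image of the group of automorphisms fixing `H_{l-1}`. -/
theorem characteristic_mem_autMod_iff (hk : 2 ≤ k) {l : ℕ} (hl : l + 1 < k) {β : MulAut G} :
    MulAut.characteristic (Subgroup.zpowers (h (l + 1))) β ∈
      autMod (Subgroup.zpowers (h (l + 1))) (Subgroup.zpowers (h 1)) ↔ β (h l) = h l := by
  have hpos : 0 < p := by
    rcases Nat.eq_zero_or_pos p with rfl | h0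
    · have := hh (l + 1) hl
      rw [zero_pow (by omega)] at this
      exact absurd this (orderOf_pos _).ne'
    · exact h0
  -- Z is the p-torsion of G, and the p-th powers of elements of H_{l+1} form H_l.
  have key : ∀ x : G, x⁻¹ * β x ∈ Subgroup.zpowers (h 1) ↔ β (x ^ p) = x ^ p := by
    intro x
    rw [mem_zpowers_one_iff hh hk, Commute.mul_pow (mul_comm' _ _), inv_pow, inv_mul_eq_one,
      map_pow, eq_comm]
  have h1 : ∀ x : Subgroup.zpowers (h (l + 1)), (x : G) ^ p ∈ Subgroup.zpowers (h l) := by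
    intro x
    rw [mem_zpowers_iff_orderOf_dvd, hh l (by omega)]
    refine orderOf_dvd_of_pow_eq_one ?_
    rw [← pow_mul, mul_comm, ← pow_succ, ← hh (l + 1) hl]
    exact orderOf_dvd_iff_pow_eq_one.1 (orderOf_dvd_of_mem_zpowers x.2)
  constructor
  · intro H
    have h2 := (key _).1 (H ⟨h (l + 1), Subgroup.mem_zpowers _⟩)
    change β (h (l + 1) ^ p) = h (l + 1) ^ p at h2
    have h3 : h l ∈ Subgroup.zpowers (h (l + 1) ^ p) := by
      rw [mem_zpowers_iff_orderOf_dvd, hh l (by omega), orderOf_pow_of_dvd hpos.ne', hh _ hl,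
        pow_succ, Nat.mul_div_cancel _ hpos]
      rw [hh _ hl]
      exact Dvd.intro_left _ rfl
    obtain ⟨n, hn⟩ := Subgroup.mem_zpowers_iff.1 h3
    rw [← hn, map_zpow, h2]
  · intro H x
    refine (key x).2 ?_
    obtain ⟨n, hn⟩ := Subgroup.mem_zpowers_iff.1 (h1 x)
    rw [← hn, map_zpow, H]

include hp

theorem ker_inf_autMod_eq_bot_iff_exists (hk : 2 ≤ k) {l : ℕ} (hl1 : 1 ≤ l) (hl : l + 1 < k)
    (φ : MulAut (Subgroup.zpowers (h (l + 1))) →* ℂˣ) :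
    φ.ker ⊓ autMod (Subgroup.zpowers (h (l + 1))) (Subgroup.zpowers (h 1)) = ⊥ ↔
      ∃ β : MulAut G, β (h l) = h l ∧
        φ (MulAut.characteristic (Subgroup.zpowers (h (l + 1))) β) ≠ 1 := by
  rw [ker_inf_autMod_eq_bot_iff hp hh hk (by omega) hl]
  constructor
  · rintro ⟨γ, hγ, hφ⟩
    obtain ⟨β, rfl⟩ := characteristic_surjective _ γ
    exact ⟨β, (characteristic_mem_autMod_iff hh hk hl).1 hγ, hφ⟩
  · rintro ⟨β, hβ, hφ⟩
    exact ⟨_, (characteristic_mem_autMod_iff hh hk hl).2 hβ, hφ⟩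

omit hp hh in
theorem comp_characteristic_eq_one_iff {l : ℕ} (φ : MulAut (Subgroup.zpowers (h l)) →* ℂˣ) :
    φ.comp (MulAut.characteristic (Subgroup.zpowers (h l))) = 1 ↔ φ = 1 := by
  constructor
  · intro H
    ext γ
    obtain ⟨β, rfl⟩ := characteristic_surjective _ γ
    exact congrArg _ (DFunLike.congr_fun H β)
  · rintro rfl
    rfl

/-- The level of a basis vector: the `l` with `e_{G,l,φ}` as leading term. -/
def kernelLevel (k : ℕ) (h : ℕ → G) : KernelIndex k h → ℕ :=
  Sum.elim (Sum.elim (fun i => i.1.1) (fun _ => 1)) (fun _ => 0)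

omit [Finite G] [IsCyclic G] hp hh in
theorem kernelLevel_lt (hk : 2 ≤ k) (i : KernelIndex k h) : kernelLevel k h i < k := by
  rcases i with (i | φ) | i
  · exact i.1.1.2
  · exact hk
  · change 0 < k
    omega

omit [Finite G] hp hh in
theorem kernelChar_eq_one_of_fix (i : KernelIndex k h) {β : MulAut G}
    (hβ : β (h (kernelLevel k h i)) = h (kernelLevel k h i)) : kernelChar k h i β = 1 := by
  rcases i with (i | φ) | i
  · have := (characteristic_eq_one_iff (h := h i.1.1)).2 hβ
    change i.1.2 (MulAut.characteristic _ β) = 1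
    rw [this, map_one]
  · have := (characteristic_eq_one_iff (h := h 1)).2 hβ
    change φ.1 (MulAut.characteristic _ β) = 1
    rw [this, map_one]
  · rfl

/-- Together with `kernelChar_eq_one_of_fix` this makes the level the least m such that the
character is trivial on the stabilizer of h_m, hence an invariant of the character. -/
theorem exists_kernelChar_ne_one (hk : 2 ≤ k) (i : KernelIndex k h) {m : ℕ}
    (hm : m < kernelLevel k h i) : ∃ β : MulAut G, β (h m) = h m ∧ kernelChar k h i β ≠ 1 := by
  rcases i with (⟨⟨⟨l, hl⟩, φ⟩, hl2, hφ⟩ | φ) | i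
  · obtain ⟨l, rfl⟩ : ∃ n, l = n + 1 := ⟨l - 1, by simp only at hl2; omega⟩
    obtain ⟨β, hβ, hne⟩ := (ker_inf_autMod_eq_bot_iff_exists hp hh hk
      (by simp only at hl2; omega) hl φ).1 hφ
    refine ⟨β, mulAut_fix_of_le hh (m := l) ?_ (by omega) hβ, hne⟩
    change m < l + 1 at hm
    omega
  · obtain rfl : m = 0 := Nat.lt_one_iff.1 hm
    have h1 := mt (comp_characteristic_eq_one_iff φ.1).1 φ.2
    obtain ⟨β, hβ⟩ := DFunLike.ne_iff.1 h1
    refine ⟨β, ?_, hβ⟩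
    have h0 : h 0 = 1 := orderOf_eq_one_iff.1 (by rw [hh 0 (by omega), pow_zero])
    rw [h0, map_one]
  · exact absurd hm (Nat.not_lt_zero _)

/-- The character determines the level, and then φ, because Aut(G) → Aut(H_l) is surjective. -/
theorem kernelChar_injective (hk : 2 ≤ k) : Function.Injective (kernelChar k h) := by
  intro i j hij
  have key : ∀ i j : KernelIndex k h, kernelChar k h i = kernelChar k h j →
      kernelLevel k h j ≤ kernelLevel k h i := by
    intro i j hij
    by_contra! hlt
    obtain ⟨β, hβ, hne⟩ := exists_kernelChar_ne_one hp hh hk j hlt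
    exact hne (hij ▸ kernelChar_eq_one_of_fix i hβ)
  have hl := le_antisymm (key j i hij.symm) (key i j hij)
  have hcomp : ∀ {l : ℕ} {φ ψ : MulAut (Subgroup.zpowers (h l)) →* ℂˣ},
      φ.comp (MulAut.characteristic (Subgroup.zpowers (h l))) =
        ψ.comp (MulAut.characteristic (Subgroup.zpowers (h l))) → φ = ψ := by
    intro l φ ψ H
    exact (MonoidHom.cancel_right (characteristic_surjective _)).1 H
  rcases i with (⟨⟨⟨l, hl'⟩, φ⟩, hl2, hφ⟩ | φ) | i <;>
    rcases j with (⟨⟨⟨m, hm'⟩, ψ⟩, hm2, hψ⟩ | ψ) | j <;>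
    simp only [kernelLevel, Sum.elim_inl, Sum.elim_inr] at hl
  · subst hl
    obtain rfl : φ = ψ := hcomp hij
    rfl
  · exact absurd (hl ▸ hl2 : 2 ≤ 1) (by omega)
  · exact absurd (hl ▸ hl2 : 2 ≤ 0) (by omega)
  · exact absurd (hl ▸ hm2 : 2 ≤ 1) (by omega)
  · exact congrArg _ (congrArg _ (Subtype.ext (hcomp hij)))
  · omega
  · exact absurd (hl ▸ hm2 : 2 ≤ 0) (by omega)
  · omega
  · rfl

include hG

theorem range_kernelChar (hk : 2 ≤ k) (χ : MulAut G →* ℂˣ) :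
    (∃ i, kernelChar k h i = χ) ↔ ¬ IsPrimitiveChar χ := by
  classical
  rw [not_isPrimitiveChar_iff hp hG (by omega) (hh (k - 1) (by omega))]
  constructor
  · rintro ⟨i, rfl⟩ β hβ
    have := kernelLevel_lt hk i
    exact kernelChar_eq_one_of_fix i (mulAut_fix_of_le hh (by omega) (by omega) hβ)
  · intro hχ
    have hex : ∃ l, ∀ β : MulAut G, β (h l) = h l → χ β = 1 := ⟨_, hχ⟩
    -- At the least such l, χ descends to a character φ of Aut(H_l). Minimality supplies the
    -- condition on φ: nontrivial for l = 1, nontrivial on Aut_Z(H_l) for l ≥ 2; l = 0 means χ = 1.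
    obtain ⟨l, hl, hmin⟩ : ∃ l, (∀ β : MulAut G, β (h l) = h l → χ β = 1) ∧
        ∀ m < l, ¬ ∀ β : MulAut G, β (h m) = h m → χ β = 1 :=
      ⟨Nat.find hex, Nat.find_spec hex, fun m hm => Nat.find_min hex hm⟩
    have hlk : l < k := by
      by_contra! h0
      exact hmin (k - 1) (by omega) hχ
    have hle : (MulAut.characteristic (Subgroup.zpowers (h l))).ker ≤ χ.ker := by
      intro β hβ
      exact hl β (characteristic_eq_one_iff.1 hβ)
    obtain ⟨φ, hφ⟩ : ∃ φ : MulAut (Subgroup.zpowers (h l)) →* ℂˣ,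
        φ.comp (MulAut.characteristic (Subgroup.zpowers (h l))) = χ :=
      ⟨MonoidHom.liftOfSurjective _ (characteristic_surjective _) ⟨χ, hle⟩,
        MonoidHom.liftOfRightInverse_comp _ _ _ _⟩
    rcases l with _ | _ | l
    · refine ⟨Sum.inr (), ?_⟩
      have h0 : h 0 = 1 := orderOf_eq_one_iff.1 (by rw [hh 0 (by omega), pow_zero])
      ext β
      exact congrArg _ (hl β (by rw [h0, map_one])).symm
    · refine ⟨Sum.inl (Sum.inr ⟨φ, ?_⟩), hφ⟩
      rintro rfl
      exact hmin 0 (by omega) fun β _ => by rw [← hφ]; rfl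
    · refine ⟨Sum.inl (Sum.inl ⟨⟨⟨l + 2, hlk⟩, φ⟩, by simp, ?_⟩), hφ⟩
      refine (ker_inf_autMod_eq_bot_iff_exists hp hh hk (l := l + 1) (by omega) hlk φ).2 ?_
      have := hmin (l + 1) (by omega)
      push Not at this
      obtain ⟨β, hβ, hne⟩ := this
      exact ⟨β, hβ, by rwa [← hφ] at hne⟩

theorem linearIndependent_kernelFamily (hk : 2 ≤ k) :
    LinearIndependent ℂ (kernelFamily p k h) :=
  linearIndependent_of_char (autRep G) (kernelChar_injective hp hh hk)
    (autRep_kernelFamily hp hG hh hk) (kernelFamily_ne_zero hp hG hh hk)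

theorem restrictionKernel_le_comap (hk : 2 ≤ k) (β : MulAut G) :
    restrictionKernel p G ≤ (restrictionKernel p G).comap (autRep G β) := by
  conv_lhs => rw [← span_kernelFamily hp hG hh hk]
  rw [Submodule.span_le]
  rintro _ ⟨i, rfl⟩
  change autRep G β (kernelFamily p k h i) ∈ restrictionKernel p G
  rw [autRep_kernelFamily hp hG hh hk]
  exact Submodule.smul_mem _ _ (kernelFamily_mem hp hG hh hk i)

/-- The basis vectors of the restriction kernel correspond to the non-primitive characters. -/
def kernelEquiv (hk : 2 ≤ k) :
    KernelIndex k h ≃ {χ : MulAut G →* ℂˣ // ¬ IsPrimitiveChar χ} :=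
  Equiv.ofBijective
    (fun i => ⟨kernelChar k h i, (range_kernelChar hp hG hh hk _).1 ⟨i, rfl⟩⟩)
    ⟨fun _ _ hij => kernelChar_injective hp hh hk (congrArg Subtype.val hij), fun χ => by
      obtain ⟨i, hi⟩ := (range_kernelChar hp hG hh hk χ.1).2 χ.2
      exact ⟨i, Subtype.ext hi⟩⟩

theorem nonempty_restrictionKernel_equiv (hk : 2 ≤ k) :
    Nonempty (((autRep G).subrepresentation (restrictionKernel p G)
      (restrictionKernel_le_comap hp hG hh hk)).Equiv (Representation.directSum
        fun χ : {χ : MulAut G →* ℂˣ // ¬ IsPrimitiveChar χ} => charRep χ.1)) := by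
  exact nonempty_subrepresentation_equiv (autRep G) _ (linearIndependent_kernelFamily hp hG hh hk)
    (span_kernelFamily hp hG hh hk) (kernelEquiv hp hG hh hk)
    fun i β => autRep_kernelFamily hp hG hh hk i β

end PGroup

end MonomialBurnside

end

theorem mainTheorem5 {G : Type u} [Group G] [Finite G] [IsCyclic G] (p k : ℕ) (hp : p.Prime)
    (hk : 2 ≤ k) (hG : Nat.card G = p ^ k)
    -- `h l` is a generator of the subgroup `H_l` of order `p ^ l`
    (h : ℕ → G) (hh : ∀ l < k, orderOf (h l) = p ^ l) :
    -- the primitive idempotents `e_{G,g}^G` exist and are unique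
    (∀ g : G, IsPrimIdem ⊤ g (primIdem ⊤ g) ∧
      ∀ x : MonBurnside G, IsPrimIdem ⊤ g x → x = primIdem ⊤ g) ∧
    -- the `e_{G,l,φ}` form a basis of `ẽ_G^G 𝕊_p(G)`
    (LinearIndependent ℂ
        (fun i : Σ l : Fin k, (MulAut (Subgroup.zpowers (h l)) →* ℂˣ) => eChar (h i.1) i.2) ∧
      Submodule.span ℂ (Set.range
        (fun i : Σ l : Fin k, (MulAut (Subgroup.zpowers (h l)) →* ℂˣ) => eChar (h i.1) i.2)) =
        eTildeKerLin G) ∧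
    -- the action of `Aut(G)` on them is monomial
    (∀ l < k, ∀ (φ : MulAut (Subgroup.zpowers (h l)) →* ℂˣ) (β : MulAut G),
      autRep G β (eChar (h l) φ) =
        (φ (MulAut.characteristic (Subgroup.zpowers (h l)) β) : ℂ) • eChar (h l) φ) ∧
    -- the ones killed by deflation to `G/Z`, where `Z = H_1`
    (∀ l, 2 ≤ l → l < k → ∀ φ : MulAut (Subgroup.zpowers (h l)) →* ℂˣ,
      eChar (h l) φ ∈ LinearMap.ker (deflation (Subgroup.zpowers (h 1))) ↔
        φ.ker ⊓ autMod (Subgroup.zpowers (h l)) (Subgroup.zpowers (h 1)) = ⊥) ∧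
    -- the restriction kernel and its basis
    restrictionKernel p G =
      eTildeKerLin G ⊓ LinearMap.ker (deflation (Subgroup.zpowers (h 1))) ∧
    (∀ b : ({i : Σ l : Fin k, (MulAut (Subgroup.zpowers (h l)) →* ℂˣ) //
          2 ≤ (i.1 : ℕ) ∧
            i.2.ker ⊓ autMod (Subgroup.zpowers (h i.1)) (Subgroup.zpowers (h 1)) = ⊥} ⊕
        {φ : MulAut (Subgroup.zpowers (h 1)) →* ℂˣ // φ ≠ 1}) ⊕ Unit → MonBurnside G,
      b = Sum.elim
          (Sum.elim (fun i => eChar (h i.1.1) i.1.2) (fun φ => eChar (h 1) φ.1))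
          (fun _ => eChar (h 1) 1 + (1 - (p : ℂ)) • eChar (h 0) 1) →
      LinearIndependent ℂ b ∧ Submodule.span ℂ (Set.range b) = restrictionKernel p G) ∧
    -- the linear characters `χ` of `Aut(G)` give all irreducible `ℂ[Aut(G)]`-modules, each once
    (∀ χ : MulAut G →* ℂˣ, (charRep χ).IsIrreducible) ∧
    (∀ (V : Type) [AddCommGroup V] [Module ℂ V] (σ : Representation ℂ (MulAut G) V),
      σ.IsIrreducible → ∃! χ : MulAut G →* ℂˣ, Nonempty (σ.Equiv (charRep χ))) ∧
    -- the restriction kernel is the direct sum of the non-primitive ones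
    ∃ hinv : ∀ β : MulAut G,
        restrictionKernel p G ≤ (restrictionKernel p G).comap (autRep G β),
      Nonempty (((autRep G).subrepresentation (restrictionKernel p G) hinv).Equiv
        (Representation.directSum
          fun χ : {χ : MulAut G →* ℂˣ // ¬ IsPrimitiveChar χ} => charRep χ.1)) := by
  have hM := le_zpowers_iff_ne_top hp hG hh hk
  refine ⟨fun g => ⟨primIdem_spec hM g, fun x hx => hx.unique (primIdem_spec hM g)⟩,
    ⟨linearIndependent_eChar hp hG hh hk, span_eChar hp hG hh hk⟩,
    fun l _ φ β => autRep_eChar hM (h l) φ β,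
    fun l hl2 hl φ => eChar_mem_ker_deflation_iff hp hG hh hk hl2 hl φ,
    restrictionKernel_eq hp hG hh hk, ?_, charRep_isIrreducible,
    fun V _ _ σ hσ => existsUnique_charRep_equiv σ hσ,
    restrictionKernel_le_comap hp hG hh hk, nonempty_restrictionKernel_equiv hp hG hh hk⟩
  rintro b rfl
  exact ⟨linearIndependent_kernelFamily hp hG hh hk, span_kernelFamily hp hG hh hk⟩
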